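/- Let $n\ge 1$ and let $K\subset\mathbb{R}^n$ be a compact convex set containing the origin $o$ in its interior, with volume $|K|$, support function $h_K(u)=\max_{y\in K}u\cdot y$ and Minkowski functional $\|x\|_K=\inf\{\lambda\ge 0: x\in\lambda K\}$. The classical LYZ ellipsoid $\Gamma_{-2}K=\{ru:\ u\in S^{n-1},\ 0\le r\le\rho_{\Gamma_{-2}K}(u)\}$ is given by its radial function $$\rho_{\Gamma_{-2}K}(u)^{-2}=\frac1{|K|}\int_{\partial K}|u\cdot n_K(x)|^2\,h_K(n_K(x))^{-1}\,d\mathcal{H}^{n-1}(x),\qquad u\in S^{n-1},$$ where $n_K(x)$ is the outer unit normal of $K$ at $x$ (unique for $\mathcal{H}^{n-1}$-almost every $x\in\partial K$) and $\mathcal{H}^{n-1}$ is the Hausdorff measure normalized to agree with Lebesgue measure on $\mathbb{R}^{n-1}$. Let ${\rm LC}_n$ be the class of upper semicontinuous log-concave functions $f=e^{-\varphi}$ on $\mathbb{R}^n$ with $\varphi$ finite everywhere and $0<J(f)<\infty$, where $J(f)=\int_{\mathbb{R}^n}f\,dx$. Let $\varphi^*(y)=\sup_x\{x\cdot y-\varphi(x)\}\in\mathbb{R}\cup\{\infty\}$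 be the Legendre transform. For $f=e^{-\varphi}\in{\rm LC}_n$ and $t>0$ put $f\oplus t\cdot f=e^{-(\varphi^*+t\varphi^*)^*}$ and $$\delta J(f,f)=\lim_{t\to0^+}\frac{J(f\oplus t\cdot f)-J(f)}{t},$$ and let $\mu_f$ be the surface area measure $\mu_f(A)=\int_{\{x:\nabla\varphi(x)\in A\}}f(x)\,dx$ for Borel $A\subset\mathbb{R}^n$. If $\varphi^*>0$ on $\mathbb{R}^n\setminus\{o\}$, the LYZ ellipsoid $\Gamma_{-2}f$ of $f$ is the function defined by $$-\log\Gamma_{-2}f(x)=\frac{n^2}{8\,\delta J(f,f)}\int_{\mathbb{R}^n}|x\cdot y|^2\,\varphi^*(y)^{-1}\,d\mu_f(y),\qquad x\in\mathbb{R}^n.$$ Then, for $f(x)=e^{-\|x\|_K^2/2}$, both ellipsoids are well defined: the integrals above converge, $\rho_{\Gamma_{-2}K}(u)^{-2}>0$ for every $u\in S^{n-1}$, $f\in{\rm LC}_n$, $\varphi^*>0$ on $\mathbb{R}^n\setminus\{o\}$, and the limit $\delta J(f,f)$ exists and is positive. Moreover, $$\Gamma_{-2}f(x)=e^{-\|x\|_{\Gamma_{-2}K}^2/2}\qquad\text{for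 all }x\in\mathbb{R}^n.$$ In particular, $\Gamma_{-2}\gamma_n=\gamma_n$ for the Gaussian $\gamma_n(x)=e^{-|x|^2/2}$. -/

import Mathlib

open MeasureTheory Filter Topology

noncomputable section

namespace LYZ

/-- `ℝⁿ` with its Euclidean structure. -/
abbrev Space (n : ℕ) : Type := EuclideanSpace ℝ (Fin n)

variable {n : ℕ}

/-! ### The LYZ ellipsoid of a convex body -/

/-- The support function `h_K(u) = max {u · y : y ∈ K}`. -/
def supportFun (K : Set (Space n)) (u : Space n) : ℝ :=
  sSup ((fun y => inner ℝ u y) '' K)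

/-- `u` is an outer unit normal vector of `K` at `x`. -/
def IsOuterUnitNormal (K : Set (Space n)) (x u : Space n) : Prop :=
  ‖u‖ = 1 ∧ ∀ y ∈ K, inner ℝ y u ≤ inner ℝ x u

open Classical in
/-- The outer unit normal vector `n_K(x)` at a boundary point `x` where it is unique (almost every
boundary point of a convex body); the value at the other points is set to `0`. -/
def outerNormal (K : Set (Space n)) (x : Space n) : Space n :=
  if h : ∃! u, IsOuterUnitNormal K x u then h.exists.choose else 0

/-- The integrand `x ↦ |u · n_K(x)|² h_K(n_K(x))⁻¹` on the boundary of `K`. -/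
def bodyIntegrand (K : Set (Space n)) (u x : Space n) : ℝ :=
  |inner ℝ u (outerNormal K x)| ^ 2 * (supportFun K (outerNormal K x))⁻¹

/-- `|K|⁻¹ ∫_{∂K} |u · n_K(x)|² h_K(n_K(x))⁻¹ dℋⁿ⁻¹(x)`, the power `-2` of the radial function of
the LYZ ellipsoid.  Here `μHE[n - 1]` is the Hausdorff measure in its geometric normalization (it
agrees with Lebesgue measure on `ℝⁿ⁻¹`). -/
def bodyForm (K : Set (Space n)) (u : Space n) : ℝ :=
  (1 / volume.real K) * ∫ x in frontier K, bodyIntegrand K u x ∂(μHE[n - 1])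

/-- The radial function of the LYZ ellipsoid in the unit direction `u`. -/
def bodyRadial (K : Set (Space n)) (u : Space n) : ℝ :=
  1 / √(bodyForm K u)

/-- The LYZ ellipsoid `Γ₋₂K`: the star body whose radial function on the unit sphere is
`bodyRadial K`. -/
def bodyEllipsoid (K : Set (Space n)) : Set (Space n) :=
  {x | ∃ u : Space n, ‖u‖ = 1 ∧ ∃ r : ℝ, 0 ≤ r ∧ r ≤ bodyRadial K u ∧ x = r • u}

/-! ### The LYZ ellipsoid of a log-concave function -/

/-- The function `φ : ℝⁿ → ℝ ∪ {∞}` with `f = e^{-φ}`, for `f ≥ 0`. -/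
def potential (f : Space n → ℝ) (x : Space n) : EReal :=
  -ENNReal.log (ENNReal.ofReal (f x))

/-- The function `e^{-φ}`. -/
def expNeg (φ : Space n → EReal) (x : Space n) : ℝ :=
  (EReal.exp (-φ x)).toReal

/-- The Legendre transform `φ*(y) = sup_x (x · y - φ(x))`, which may be infinite. -/
def legendre (φ : Space n → EReal) (y : Space n) : EReal :=
  ⨆ x : Space n, ((inner ℝ x y : ℝ) : EReal) - φ x

/-- The total mass `J(f)`. -/
def mass (f : Space n → ℝ) : ℝ := ∫ x, f x

/-- The class `LCₙ`: upper semicontinuous log-concave functions `f = e^{-φ}` with `φ` finite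
everywhere and `0 < J(f) < ∞`. -/
structure IsLC (f : Space n → ℝ) : Prop where
  pos : ∀ x, 0 < f x
  logConcave : ConcaveOn ℝ Set.univ (fun x => Real.log (f x))
  upperSemicontinuous : UpperSemicontinuous f
  integrable : Integrable f
  mass_pos : 0 < mass f

/-- The Asplund sum `α·f ⊕ β·g = exp (-(α φ* + β ψ*)*)` of `f = e^{-φ}` and `g = e^{-ψ}`. -/
def asplundSum (α : ℝ) (f : Space n → ℝ) (β : ℝ) (g : Space n → ℝ) : Space n → ℝ :=
  expNeg (legendre fun y =>
    (α : EReal) * legendre (potential f) y + (β : EReal) * legendre (potential g) y)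

/-- The difference quotient `(J(f ⊕ t·g) - J(f)) / t`. -/
def massQuotient (f g : Space n → ℝ) (t : ℝ) : ℝ :=
  (mass (asplundSum 1 f t g) - mass f) / t

/-- The first variation `δJ(f,g) = lim_{t → 0⁺} (J(f ⊕ t·g) - J(f)) / t`. -/
def firstVariation (f g : Space n → ℝ) : ℝ :=
  limUnder (𝓝[>] (0 : ℝ)) (massQuotient f g)

/-- The surface area measure `μ_f(A) = ∫_{∇φ(x) ∈ A} f(x) dx` of `f = e^{-φ}`. -/
def surfaceMeasure (f : Space n → ℝ) : Measure (Space n) :=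
  (volume.withDensity fun x => ENNReal.ofReal (f x)).map
    (gradient fun x => (potential f x).toReal)

/-- The integrand `y ↦ |x · y|² φ*(y)⁻¹`, with `1 / ∞ = 0`. -/
def funIntegrand (f : Space n → ℝ) (x y : Space n) : ℝ :=
  |inner ℝ x y| ^ 2 * ((legendre (potential f) y)⁻¹).toReal

/-- The LYZ ellipsoid `Γ₋₂f` of a log-concave function:
`-log Γ₋₂f(x) = n² / (8 δJ(f,f)) ∫ |x · y|² φ*(y)⁻¹ dμ_f(y)`. -/
def funEllipsoid (f : Space n → ℝ) (x : Space n) : ℝ :=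
  Real.exp (-((n : ℝ) ^ 2 / (8 * firstVariation f f) *
    ∫ y, funIntegrand f x y ∂(surfaceMeasure f)))

/-- The function `x ↦ exp (-‖x‖_K² / 2)`, where `‖·‖_K` is the Minkowski functional of `K`. -/
def expNegGauge (K : Set (Space n)) (x : Space n) : ℝ :=
  Real.exp (-(gauge K x ^ 2 / 2))

/-- The Gaussian `γₙ(x) = exp (-|x|² / 2)`. -/
def gaussian (n : ℕ) (x : Space n) : ℝ :=
  Real.exp (-(‖x‖ ^ 2 / 2))

end LYZ

end

/-!
For a convex body `K` with gauge `g = ‖·‖_K` and support function `h`, both ellipsoids are expressed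
through one quadratic form, `gradientForm K u = ∫_K (u · ∇g)² dz`.

*The body.* At a boundary point where `g` is differentiable, the outer normal is `∇g / ‖∇g‖`, and
`h (∇g) = 1`; hence the integrand of `bodyForm` is `(u · ∇g)² / ‖∇g‖`. On the boundary `{g = 1}` the
surface area measure has density `‖∇g‖` with respect to the cone measure, which gives a set `n` times
the volume of the cone over it (`IsGauge.area_eq_withDensity_coneMeasure`). As `∇g` is constant on
rays, `bodyForm K u = n / |K| * gradientForm K u` (`bodyForm_eq`).

The comparison of surface area and cone measure needs no area formula. By Rademacher's theorem `g` is
differentiable almost everywhere, and the points of differentiability on `{g = 1}` can be cut into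
countably many pieces on which `g` is close to a linear functional. The central projection of such a
piece to the level hyperplane of the functional is bi-Lipschitz with constants close to `1`, so it
nearly preserves both the Hausdorff measure and the volume of the cone; for pieces of a hyperplane the
claim is the formula for the volume of a cone, by Fubini's theorem. The remaining boundary points form
a set of zero cone measure, which has zero area because the boundary is locally the image of a piece of
a hyperplane under the radial projection, a Lipschitz map.

*The function.* For `f = exp (-g² / 2)` the Legendre transform of the potential is `h² / 2`, and
`f ⊕ t · f = exp (-g² / (2 (1 + t)))` by the Hahn–Banach theorem, so `J (f ⊕ t · f) = (1 + t)^(n/2) J(f)`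
and `δJ(f, f) = n J(f) / 2`. In the integral against the surface area measure the potential has gradient
`g ∇g`, so the integrand becomes `2 (x · ∇g)² f`. As `∇g` is constant on rays, integration over the layers
of `f`, which are dilates of `K`, yields `2 J(f) / |K| * gradientForm K x`. Altogether
`-log Γ₋₂f = bodyForm K / 2`, and `√(bodyForm K)` is the gauge of `Γ₋₂K`.

For the unit ball, the form `gradientForm` is rotation invariant with trace `|K|`, so that
`bodyForm K x = |x|²`.
-/

open Set Module
open scoped ENNReal NNReal Pointwise InnerProductSpace

section

variable {E : Type*} [NormedAddCommGroup E] [InnerProductSpace ℝ E] [FiniteDimensional ℝ E]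
  [MeasurableSpace E] [BorelSpace E]

/-! ### Cones over subsets of a hypersurface -/

/-- The cone with apex `0` over a set `S`, the apex being left out: the union of the half-open
segments from `0` to the points of `S`. -/
def coneOver {E : Type*} [AddCommGroup E] [Module ℝ E] (S : Set E) : Set E :=
  {z | ∃ t ∈ Ioc (0 : ℝ) 1, ∃ x ∈ S, t • x = z}

omit [FiniteDimensional ℝ E] [MeasurableSpace E] [BorelSpace E] in
theorem coneOver_eq_of_inner_eq_one {a : E} {S : Set E} (hSa : ∀ x ∈ S, ⟪a, x⟫_ℝ = 1) :
    coneOver S = (fun z => ⟪a, z⟫_ℝ) ⁻¹' Ioc 0 1 ∩ (fun z => (⟪a, z⟫_ℝ)⁻¹ • z) ⁻¹' S := by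
  ext z
  constructor
  · rintro ⟨t, ht, x, hx, rfl⟩
    have : ⟪a, t • x⟫_ℝ = t := by rw [real_inner_smul_right, hSa x hx, mul_one]
    simp only [mem_inter_iff, mem_preimage, this, smul_smul, inv_mul_cancel₀ ht.1.ne', one_smul]
    exact ⟨ht, hx⟩
  · rintro ⟨h1, h2⟩
    exact ⟨_, h1, _, h2, by simp [smul_smul, mul_inv_cancel₀ h1.1.ne']⟩

theorem lintegral_Ioc_ofReal_pow (m : ℕ) :
    ∫⁻ x in Ioc (0 : ℝ) 1, ENNReal.ofReal (x ^ m) = ENNReal.ofReal ((m + 1 : ℝ)⁻¹) := by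
  rw [← ofReal_integral_eq_lintegral_ofReal]
  · rw [← intervalIntegral.integral_of_le zero_le_one, integral_pow]
    simp
  · exact (continuous_pow m).integrableOn_Ioc
  · filter_upwards [ae_restrict_mem measurableSet_Ioc] with x hx using pow_nonneg hx.1.le _

/-- The volume of a cone over a piece `S` of the hyperplane `{x | ⟪a, x⟫ = 1}`, which has distance
`‖a‖⁻¹` from the origin: base times height over dimension. -/
theorem volume_coneOver_of_inner_eq_one {a : E} (ha : a ≠ 0) {S : Set E}
    (hS : MeasurableSet S) (hSa : ∀ x ∈ S, ⟪a, x⟫_ℝ = 1) :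
    finrank ℝ E * ‖a‖ₑ * volume (coneOver S) = μHE[finrank ℝ E - 1] S := by
  have : Nontrivial E := ⟨a, 0, ha⟩
  have hn : 0 < finrank ℝ E := finrank_pos
  have hmeas : MeasurableSet (coneOver S) := by
    rw [coneOver_eq_of_inner_eq_one hSa]
    have h1 : Measurable fun z : E => ⟪a, z⟫_ℝ := by fun_prop
    exact (h1 measurableSet_Ioc).inter ((h1.inv.smul measurable_id) hS)
  have ha' : 0 < ‖a‖ := norm_pos_iff.2 ha
  -- `v` is the point of the hyperplane nearest to the origin, so the slice of the cone through `x • v`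
  -- orthogonal to `v` is `x • S` for `x ∈ (0, 1]`, and empty otherwise.
  set v : E := (‖a‖ ^ 2)⁻¹ • a with hv
  have hv0 : v ≠ 0 := smul_ne_zero (by positivity) ha
  have hav : ⟪a, v⟫_ℝ = 1 := by
    rw [hv, real_inner_smul_right, real_inner_self_eq_norm_sq, inv_mul_cancel₀ (by positivity)]
  have hnv : ‖a‖ₑ * ‖v‖ₑ = 1 := by
    rw [hv, enorm_smul, ← mul_assoc, mul_comm, ← mul_assoc, ← enorm_norm a, ← enorm_mul, ← enorm_mul,
      ← sq, mul_inv_cancel₀ (by positivity), enorm_one]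
  have hslice : ∀ x : ℝ, μHE[finrank ℝ E - 1]
        (coneOver S ∩ AffineSubspace.mk' (x • v +ᵥ (0 : E)) (ℝ ∙ v)ᗮ) =
      (Ioc (0 : ℝ) 1).indicator
        (fun x => ENNReal.ofReal (x ^ (finrank ℝ E - 1)) * μHE[finrank ℝ E - 1] S) x := by
    intro x
    have hmem : ∀ z : E, z ∈ (AffineSubspace.mk' (x • v +ᵥ (0 : E)) (ℝ ∙ v)ᗮ : Set E) ↔
        ⟪a, z⟫_ℝ = x := by
      intro z
      rw [SetLike.mem_coe, AffineSubspace.mem_mk', Submodule.mem_orthogonal_singleton_iff_inner_right,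
        vadd_eq_add, add_zero, vsub_eq_sub, hv, real_inner_smul_left, inner_sub_right, ← hv,
        real_inner_smul_right, hav, mul_one, mul_eq_zero, sub_eq_zero]
      simp [ha]
    by_cases hx : x ∈ Ioc (0 : ℝ) 1
    · have : coneOver S ∩ AffineSubspace.mk' (x • v +ᵥ (0 : E)) (ℝ ∙ v)ᗮ = x • S := by
        ext z
        rw [mem_inter_iff, hmem, mem_smul_set]
        constructor
        · rintro ⟨⟨t, ht, y, hy, rfl⟩, h⟩
          rw [real_inner_smul_right, hSa y hy, mul_one] at h
          exact ⟨y, hy, by rw [h]⟩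
        · rintro ⟨y, hy, rfl⟩
          exact ⟨⟨x, hx, y, hy, rfl⟩, by rw [real_inner_smul_right, hSa y hy, mul_one]⟩
      rw [this, indicator_of_mem hx, Measure.euclideanHausdorffMeasure_smul₀ _ hx.1.ne',
        ENNReal.smul_def, smul_eq_mul, ENNReal.coe_pow, ← enorm_eq_nnnorm,
        Real.enorm_of_nonneg hx.1.le, ENNReal.ofReal_pow hx.1.le]
    · have : coneOver S ∩ AffineSubspace.mk' (x • v +ᵥ (0 : E)) (ℝ ∙ v)ᗮ = ∅ := by
        rw [eq_empty_iff_forall_notMem]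
        rintro z ⟨⟨t, ht, y, hy, rfl⟩, h⟩
        rw [hmem, real_inner_smul_right, hSa y hy, mul_one] at h
        exact hx (h ▸ ht)
      rw [this, indicator_of_notMem hx, measure_empty]
  have hcast : ((finrank ℝ E - 1 : ℕ) : ℝ) + 1 = finrank ℝ E := by
    exact_mod_cast Nat.sub_add_cancel hn
  rw [← InnerProductSpace.euclideanHausdorffMeasure_eq_volume,
    EuclideanGeometry.euclideanHausdorffMeasure_eq_lintegral (0 : E) hv0 hmeas]
  simp_rw [hslice]
  rw [lintegral_indicator measurableSet_Ioc, lintegral_mul_const _ (by fun_prop),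
    lintegral_Ioc_ofReal_pow, hcast, ENNReal.ofReal_inv_of_pos (by positivity),
    ENNReal.ofReal_natCast, mul_assoc, ← mul_assoc ‖a‖ₑ, hnv, one_mul, ← mul_assoc,
    ENNReal.mul_inv_cancel (by simp [hn.ne']) (by simp), one_mul]

omit [FiniteDimensional ℝ E] [MeasurableSpace E] [BorelSpace E] in
/-- If every point of `S` is obtained from a point of `T` by multiplication with a factor in
`(0, θ]`, then the cone over `S` is contained in the `θ`-fold cone over `T`. -/
theorem coneOver_subset_smul {S T : Set E} {θ : ℝ}
    (h : ∀ x ∈ S, ∃ c ∈ Ioc 0 θ, ∃ y ∈ T, x = c • y) : coneOver S ⊆ θ • coneOver T := by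
  rintro _ ⟨t, ht, x, hx, rfl⟩
  obtain ⟨c, hc, y, hy, rfl⟩ := h x hx
  have hθ : 0 < θ := hc.1.trans_le hc.2
  refine ⟨(t * (c / θ)) • y, ⟨_, ⟨by have := ht.1; have := hc.1; positivity, ?_⟩, y, hy, rfl⟩, ?_⟩
  · exact mul_le_one₀ ht.2 (div_nonneg hc.1.le hθ.le) ((div_le_one hθ).2 hc.2)
  · simp only [smul_smul]
    congr 1
    field_simp

theorem volume_coneOver_le {S T : Set E} {θ : ℝ} (hθ : 0 ≤ θ)
    (h : ∀ x ∈ S, ∃ c ∈ Ioc 0 θ, ∃ y ∈ T, x = c • y) :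
    volume (coneOver S) ≤ ENNReal.ofReal θ ^ finrank ℝ E * volume (coneOver T) := by
  refine (measure_mono (coneOver_subset_smul h)).trans_eq ?_
  rw [Measure.addHaar_smul, abs_of_nonneg (by positivity), ENNReal.ofReal_pow hθ]

theorem LipschitzOnWith.euclideanHausdorffMeasure_image_le {X Y : Type*} [EMetricSpace X]
    [MeasurableSpace X] [BorelSpace X] [EMetricSpace Y] [MeasurableSpace Y] [BorelSpace Y]
    {C : ℝ≥0} {f : X → Y} {s : Set X} (h : LipschitzOnWith C f s) (d : ℕ) :
    μHE[d] (f '' s) ≤ (C : ℝ≥0∞) ^ d * μHE[d] s := by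
  rw [Measure.euclideanHausdorffMeasure_def, Measure.euclideanHausdorffMeasure_def,
    Measure.smul_apply, Measure.smul_apply, ENNReal.smul_def, ENNReal.smul_def, smul_eq_mul,
    smul_eq_mul, mul_left_comm]
  gcongr
  simpa using h.hausdorffMeasure_image_le (d := d) (by positivity)

/-! ### Nearly flat pieces of a hypersurface -/

/-- On a set `B` whose central projection to the hyperplane `{x | ⟪a, x⟫ = 1}` changes distances at
most by the factor `θ` and moves points radially at most by the factor `θ`, the surface area is
comparable to what it would be if `B` were contained in the hyperplane. -/
theorem area_comparable_volume_coneOver {a : E} (ha : a ≠ 0) {θ : ℝ≥0} (hθ : 1 ≤ θ) {B : Set E}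
    (hB : MeasurableSet B) (h1 : ∀ x ∈ B, (θ : ℝ)⁻¹ ≤ ⟪a, x⟫_ℝ ∧ ⟪a, x⟫_ℝ ≤ θ)
    (h2 : LipschitzOnWith θ (fun x => (⟪a, x⟫_ℝ)⁻¹ • x) B)
    (h3 : ∀ x ∈ B, ∀ y ∈ B, dist x y ≤ θ * dist ((⟪a, x⟫_ℝ)⁻¹ • x) ((⟪a, y⟫_ℝ)⁻¹ • y)) :
    μHE[finrank ℝ E - 1] B ≤
        (θ : ℝ≥0∞) ^ (2 * finrank ℝ E) * (finrank ℝ E * ‖a‖ₑ * volume (coneOver B)) ∧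
      finrank ℝ E * ‖a‖ₑ * volume (coneOver B) ≤
        (θ : ℝ≥0∞) ^ (2 * finrank ℝ E) * μHE[finrank ℝ E - 1] B := by
  set R : E → E := fun x => (⟪a, x⟫_ℝ)⁻¹ • x with hR
  set n := finrank ℝ E with hn
  have hθ0 : (0 : ℝ) < θ := zero_lt_one.trans_le (by exact_mod_cast hθ)
  have hpos : ∀ x ∈ B, 0 < ⟪a, x⟫_ℝ := fun x hx => (inv_pos.2 hθ0).trans_le (h1 x hx).1
  have hinj : InjOn R B := fun x hx y hy hxy => by
    have := h3 x hx y hy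
    rw [show (⟪a, x⟫_ℝ)⁻¹ • x = (⟪a, y⟫_ℝ)⁻¹ • y from hxy, dist_self, mul_zero] at this
    exact dist_le_zero.1 this
  have hRB : MeasurableSet (R '' B) := hB.image_of_continuousOn_injOn h2.continuousOn hinj
  have hRa : ∀ x ∈ R '' B, ⟪a, x⟫_ℝ = 1 := by
    rintro _ ⟨x, hx, rfl⟩
    rw [hR, real_inner_smul_right, inv_mul_cancel₀ (hpos x hx).ne']
  have hflat := volume_coneOver_of_inner_eq_one ha hRB hRa
  have hinv : LipschitzOnWith θ (Function.invFunOn R B) (R '' B) := by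
    refine LipschitzOnWith.of_dist_le_mul ?_
    rintro _ ⟨x, hx, rfl⟩ _ ⟨y, hy, rfl⟩
    rw [hinj.leftInvOn_invFunOn hx, hinj.leftInvOn_invFunOn hy]
    exact h3 x hx y hy
  have hvol1 : volume (coneOver B) ≤ (θ : ℝ≥0∞) ^ n * volume (coneOver (R '' B)) := by
    rw [← ENNReal.ofReal_coe_nnreal]
    refine volume_coneOver_le θ.2 fun x hx => ⟨⟪a, x⟫_ℝ, ⟨hpos x hx, (h1 x hx).2⟩, R x,
      mem_image_of_mem R hx, ?_⟩
    rw [hR, smul_smul, mul_inv_cancel₀ (hpos x hx).ne', one_smul]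
  have hvol2 : volume (coneOver (R '' B)) ≤ (θ : ℝ≥0∞) ^ n * volume (coneOver B) := by
    rw [← ENNReal.ofReal_coe_nnreal]
    refine volume_coneOver_le θ.2 ?_
    rintro _ ⟨x, hx, rfl⟩
    exact ⟨_, ⟨inv_pos.2 (hpos x hx), inv_le_of_inv_le₀ hθ0 (h1 x hx).1⟩, x, hx, rfl⟩
  have hθ1 : (1 : ℝ≥0∞) ≤ θ := by exact_mod_cast hθ
  have hpow : (θ : ℝ≥0∞) ^ (n - 1) ≤ (θ : ℝ≥0∞) ^ n := pow_le_pow_right₀ hθ1 (Nat.sub_le _ _)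
  constructor
  · calc μHE[n - 1] B = μHE[n - 1] (Function.invFunOn R B '' (R '' B)) := by
          rw [hinj.leftInvOn_invFunOn.image_image]
      _ ≤ (θ : ℝ≥0∞) ^ (n - 1) * μHE[n - 1] (R '' B) := hinv.euclideanHausdorffMeasure_image_le _
      _ ≤ (θ : ℝ≥0∞) ^ n * (n * ‖a‖ₑ * ((θ : ℝ≥0∞) ^ n * volume (coneOver B))) := by
          rw [← hflat]; gcongr
      _ = _ := by ring
  · calc n * ‖a‖ₑ * volume (coneOver B)
        ≤ n * ‖a‖ₑ * ((θ : ℝ≥0∞) ^ n * volume (coneOver (R '' B))) := by gcongr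
      _ = (θ : ℝ≥0∞) ^ n * μHE[n - 1] (R '' B) := by rw [← hflat]; ring
      _ ≤ (θ : ℝ≥0∞) ^ n * ((θ : ℝ≥0∞) ^ n * μHE[n - 1] B) := by
          gcongr
          exact (h2.euclideanHausdorffMeasure_image_le _).trans (by gcongr)
      _ = _ := by ring

omit [FiniteDimensional ℝ E] [MeasurableSpace E] [BorelSpace E] in
/-- If the functional with values `p` at `x` and `q` at `y` is close to `1` at both points and varies
slowly between them, then the central projection to its level set `1` nearly preserves `‖x - y‖`. -/
theorem norm_inv_smul_sub_inv_smul_comparable {x y : E} {p q M η : ℝ} (hη0 : 0 < η) (hη1 : η < 1)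
    (hp : |p - 1| ≤ η) (hq : |q - 1| ≤ η) (hy : ‖y‖ ≤ M)
    (hpq : |p - q| * M ≤ η * (1 - η) * ‖x - y‖) :
    ‖p⁻¹ • x - q⁻¹ • y‖ ≤ (1 + η) / (1 - η) * ‖x - y‖ ∧
      ‖x - y‖ ≤ (1 + η) / (1 - η) * ‖p⁻¹ • x - q⁻¹ • y‖ := by
  have hη : 0 < 1 - η := by linarith
  obtain ⟨hp1, hp2⟩ := abs_le.1 hp
  obtain ⟨hq1, hq2⟩ := abs_le.1 hq
  have hp0 : 0 < p := by linarith
  have hq0 : 0 < q := by linarith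
  set w : E := ((p - q) / q) • y with hw
  have hRw : p⁻¹ • x - q⁻¹ • y = p⁻¹ • ((x - y) - w) := by
    rw [hw, smul_sub, smul_sub, smul_smul, sub_sub, ← add_smul]
    congr 2
    field_simp
    ring
  have hwn : ‖w‖ ≤ η * ‖x - y‖ := by
    rw [hw, norm_smul, norm_div, Real.norm_eq_abs, Real.norm_eq_abs, abs_of_pos hq0, div_mul_eq_mul_div,
      div_le_iff₀ hq0]
    calc |p - q| * ‖y‖ ≤ |p - q| * M := by gcongr
      _ ≤ η * (1 - η) * ‖x - y‖ := hpq
      _ = η * ‖x - y‖ * (1 - η) := by ring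
      _ ≤ η * ‖x - y‖ * q := by gcongr; linarith
  have h1 : ‖(x - y) - w‖ ≤ (1 + η) * ‖x - y‖ := (norm_sub_le _ _).trans (by linarith)
  have h2 : (1 - η) * ‖x - y‖ ≤ ‖(x - y) - w‖ := by
    have := norm_sub_norm_le (x - y) w
    linarith
  rw [hRw, norm_smul, norm_inv, Real.norm_eq_abs, abs_of_pos hp0]
  constructor
  · calc p⁻¹ * ‖x - y - w‖ ≤ (1 - η)⁻¹ * ((1 + η) * ‖x - y‖) := by gcongr; linarith
      _ = _ := by ring
  · rw [div_mul_eq_mul_div, le_div_iff₀ hη]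
    calc ‖x - y‖ * (1 - η) ≤ ‖x - y - w‖ := by linarith
      _ = p * (p⁻¹ * ‖x - y - w‖) := by field_simp
      _ ≤ (1 + η) * (p⁻¹ * ‖x - y - w‖) := by gcongr; linarith

end

section

variable {E : Type*} [NormedAddCommGroup E] [InnerProductSpace ℝ E]

/-! ### Gauge functions and the cone measure -/

/-- A positively homogeneous Lipschitz function that is bounded below by a positive multiple of the
norm: the gauge of a bounded star-shaped neighbourhood of the origin with Lipschitz boundary. -/
structure IsGauge (g : E → ℝ) : Prop where
  lipschitz : ∃ L, LipschitzWith L g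
  map_smul : ∀ t : ℝ, 0 ≤ t → ∀ x, g (t • x) = t * g x
  norm_le : ∃ M : ℝ, 0 < M ∧ ∀ x, ‖x‖ ≤ M * g x

/-- The central projection of `z ≠ 0` to the hypersurface `{x | g x = 1}`. -/
noncomputable def radialProj (g : E → ℝ) (z : E) : E := (g z)⁻¹ • z

namespace IsGauge

variable {g : E → ℝ}

theorem continuous (hg : IsGauge g) : Continuous g :=
  hg.lipschitz.choose_spec.continuous

theorem map_zero (hg : IsGauge g) : g 0 = 0 := by
  simpa using hg.map_smul 0 le_rfl 0

theorem nonneg (hg : IsGauge g) (x : E) : 0 ≤ g x := by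
  obtain ⟨M, hM, h⟩ := hg.norm_le
  exact nonneg_of_mul_nonneg_right ((norm_nonneg x).trans (h x)) hM

theorem pos (hg : IsGauge g) {x : E} (hx : x ≠ 0) : 0 < g x := by
  obtain ⟨M, hM, h⟩ := hg.norm_le
  exact pos_of_mul_pos_right ((norm_pos_iff.2 hx).trans_le (h x)) hM.le

theorem map_radialProj (hg : IsGauge g) {z : E} (hz : z ≠ 0) : g (radialProj g z) = 1 := by
  rw [radialProj, hg.map_smul _ (inv_nonneg.2 (hg.nonneg z)), inv_mul_cancel₀ (hg.pos hz).ne']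

theorem radialProj_smul (hg : IsGauge g) {t : ℝ} (ht : 0 < t) (z : E) :
    radialProj g (t • z) = radialProj g z := by
  rw [radialProj, radialProj, hg.map_smul _ ht.le, smul_smul, mul_inv]
  congr 1
  field_simp

theorem radialProj_of_eq_one {z : E} (hz : g z = 1) : radialProj g z = z := by
  simp [radialProj, hz]

theorem hasFDerivAt_smul (hg : IsGauge g) {x : E} {f' : E →L[ℝ] ℝ} (h : HasFDerivAt g f' x)
    {t : ℝ} (ht : 0 < t) : HasFDerivAt g f' (t • x) := by
  have hinv : g = fun z => t * g (t⁻¹ • z) := by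
    ext z
    rw [hg.map_smul _ (inv_nonneg.2 ht.le), mul_inv_cancel_left₀ ht.ne']
  have h1 : HasFDerivAt (fun z : E => t⁻¹ • z) (t⁻¹ • ContinuousLinearMap.id ℝ E) (t • x) :=
    (hasFDerivAt_id _).const_smul _
  have h2 : HasFDerivAt g f' (t⁻¹ • t • x) := by rwa [smul_smul, inv_mul_cancel₀ ht.ne', one_smul]
  have h3 := (h2.comp (t • x) h1).const_mul t
  rw [hinv]
  convert! h3 using 1
  ext z
  simp [ht.ne']

theorem fderiv_smul (hg : IsGauge g) (x : E) {t : ℝ} (ht : 0 < t) :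
    fderiv ℝ g (t • x) = fderiv ℝ g x := by
  by_cases h : DifferentiableAt ℝ g x
  · exact (hg.hasFDerivAt_smul h.hasFDerivAt ht).fderiv
  · have h' : ¬DifferentiableAt ℝ g (t • x) := fun h1 => h (by
      have := (hg.hasFDerivAt_smul h1.hasFDerivAt (inv_pos.2 ht)).differentiableAt
      rwa [smul_smul, inv_mul_cancel₀ ht.ne', one_smul] at this)
    rw [fderiv_zero_of_not_differentiableAt h, fderiv_zero_of_not_differentiableAt h']

theorem differentiableAt_radialProj (hg : IsGauge g) {x : E} (hx : x ≠ 0)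
    (h : DifferentiableAt ℝ g x) : DifferentiableAt ℝ g (radialProj g x) :=
  (hg.hasFDerivAt_smul h.hasFDerivAt (inv_pos.2 (hg.pos hx))).differentiableAt

theorem fderiv_radialProj (hg : IsGauge g) {x : E} (hx : x ≠ 0) :
    fderiv ℝ g (radialProj g x) = fderiv ℝ g x :=
  hg.fderiv_smul x (inv_pos.2 (hg.pos hx))

/-- Euler's identity for a positively homogeneous function. -/
theorem fderiv_apply_self (hg : IsGauge g) {x : E} (h : DifferentiableAt ℝ g x) :
    fderiv ℝ g x x = g x := by
  have h1 : HasDerivAt (fun t : ℝ => t • x) x 1 := by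
    simpa using (hasDerivAt_id (1 : ℝ)).smul_const x
  have h2 : HasDerivAt (fun t : ℝ => g (t • x)) (fderiv ℝ g x x) 1 := by
    have h' : HasFDerivAt g (fderiv ℝ g x) ((1 : ℝ) • x) := by simpa using h.hasFDerivAt
    exact h'.comp_hasDerivAt 1 h1
  have h3 : HasDerivAt (fun t : ℝ => g (t • x)) (g x) 1 := by
    have : HasDerivAt (fun t : ℝ => t * g x) (g x) 1 := by
      simpa using (hasDerivAt_id (1 : ℝ)).mul_const (g x)
    refine this.congr_of_eventuallyEq ?_
    filter_upwards [lt_mem_nhds zero_lt_one] with t ht using hg.map_smul t ht.le x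
  exact h2.unique h3

theorem preimage_radialProj_inter (hg : IsGauge g) {B : Set E} (hB : B ⊆ g ⁻¹' {1}) :
    radialProj g ⁻¹' B ∩ g ⁻¹' Ioc 0 1 = coneOver B := by
  ext z
  constructor
  · rintro ⟨h1, h2⟩
    exact ⟨g z, h2, _, h1, by rw [radialProj, smul_smul, mul_inv_cancel₀ h2.1.ne', one_smul]⟩
  · rintro ⟨t, ht, x, hx, rfl⟩
    have hgx : g x = 1 := hB hx
    refine ⟨?_, ?_⟩
    · rwa [mem_preimage, hg.radialProj_smul ht.1, radialProj_of_eq_one hgx]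
    · rwa [mem_preimage, hg.map_smul _ ht.1.le, hgx, mul_one]

end IsGauge

end

section

variable {E : Type*} [NormedAddCommGroup E] [InnerProductSpace ℝ E] [FiniteDimensional ℝ E]
  [MeasurableSpace E] [BorelSpace E]

/-- The cone measure of the hypersurface `{x | g x = 1}`: the measure of a set `B` is the dimension
times the volume of the cone over `B`. -/
noncomputable def coneMeasure (g : E → ℝ) : Measure E :=
  (finrank ℝ E : ℝ≥0∞) • (volume.restrict (g ⁻¹' Ioc 0 1)).map (radialProj g)

namespace IsGauge

variable {g : E → ℝ}

omit [FiniteDimensional ℝ E] in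
theorem measurable_radialProj (hg : IsGauge g) : Measurable (radialProj g) :=
  hg.continuous.measurable.inv.smul measurable_id

theorem ae_differentiableAt (hg : IsGauge g) : ∀ᵐ x, DifferentiableAt ℝ g x :=
  hg.lipschitz.choose_spec.ae_differentiableAt

theorem coneMeasure_apply (hg : IsGauge g) {B : Set E} (hB : MeasurableSet B)
    (hB1 : B ⊆ g ⁻¹' {1}) : coneMeasure g B = finrank ℝ E * volume (coneOver B) := by
  rw [coneMeasure, Measure.smul_apply, Measure.map_apply hg.measurable_radialProj hB,
    Measure.restrict_apply (hg.measurable_radialProj hB), hg.preimage_radialProj_inter hB1,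
    smul_eq_mul]

theorem ae_coneMeasure (hg : IsGauge g) :
    ∀ᵐ x ∂coneMeasure g, g x = 1 ∧ DifferentiableAt ℝ g x := by
  have hm : MeasurableSet {x | g x = 1 ∧ DifferentiableAt ℝ g x} :=
    (hg.continuous.measurable (measurableSet_singleton 1)).inter
      (measurableSet_of_differentiableAt ℝ g)
  refine Measure.ae_smul_measure ?_ _
  rw [ae_map_iff hg.measurable_radialProj.aemeasurable hm]
  rw [ae_restrict_iff' (hg.continuous.measurable measurableSet_Ioc)]
  filter_upwards [hg.ae_differentiableAt] with z hz hz1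
  have hz0 : z ≠ 0 := by
    rintro rfl
    simp [hg.map_zero] at hz1
  exact ⟨hg.map_radialProj hz0, hg.differentiableAt_radialProj hz0 hz⟩

end IsGauge

/-! ### The surface area of the unit level set of a gauge function -/

/-- An inequality of measures may be checked on the subsets of each piece of a countable cover. -/
theorem measure_le_of_countable_cover {α : Type*} [MeasurableSpace α] {μ ν : Measure α}
    {P : ℕ → Set α} (hP : ∀ i, MeasurableSet (P i)) {B : Set α} (hB : MeasurableSet B)
    (hcov : B ⊆ ⋃ i, P i)
    (h : ∀ i, ∀ C, MeasurableSet C → C ⊆ B ∩ P i → μ C ≤ ν C) : μ B ≤ ν B := by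
  have hBU : B = ⋃ i, B ∩ disjointed P i := by
    rw [← inter_iUnion, iUnion_disjointed, inter_eq_left.2 hcov]
  have hm : ∀ i, MeasurableSet (B ∩ disjointed P i) := fun i =>
    hB.inter (MeasurableSet.disjointed hP i)
  have hd : Pairwise (Function.onFun Disjoint fun i => B ∩ disjointed P i) := fun i j hij =>
    (disjoint_disjointed P hij).mono inter_subset_right inter_subset_right
  calc μ B ≤ ∑' i, μ (B ∩ disjointed P i) := by
        conv_lhs => rw [hBU]
        exact measure_iUnion_le _
    _ ≤ ∑' i, ν (B ∩ disjointed P i) := ENNReal.tsum_le_tsum fun i =>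
        h i _ (hm i) (inter_subset_inter_right _ (disjointed_subset P i))
    _ = ν B := by rw [← measure_iUnion hd hm, ← hBU]

theorem ENNReal.le_of_forall_one_lt_le_pow_mul {x y : ℝ≥0∞} {k : ℕ}
    (h : ∀ θ : ℝ≥0, 1 < θ → x ≤ (θ : ℝ≥0∞) ^ k * y) : x ≤ y := by
  have h1 : Tendsto (fun θ : ℝ≥0 => (θ : ℝ≥0∞) ^ k * y) (𝓝[>] 1) (𝓝 (((1 : ℝ≥0) : ℝ≥0∞) ^ k * y)) := by
    refine Tendsto.mono_left ?_ nhdsWithin_le_nhds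
    refine ENNReal.Tendsto.mul_const ?_ (Or.inl (by simp))
    exact ((ENNReal.continuous_pow k).comp ENNReal.continuous_coe).tendsto 1
  have h2 := ge_of_tendsto h1 (by filter_upwards [self_mem_nhdsWithin] with θ hθ using h θ hθ)
  simpa using h2

namespace IsGauge

variable {g : E → ℝ}

omit [FiniteDimensional ℝ E] [MeasurableSpace E] [BorelSpace E] in
theorem lipschitzOnWith_radialProj (hg : IsGauge g) {M c : ℝ} (hc : 0 < c) {S : Set E}
    (hS : ∀ x ∈ S, ‖x‖ ≤ M ∧ c ≤ g x) : ∃ C, LipschitzOnWith C (radialProj g) S := by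
  obtain ⟨L, hL⟩ := hg.lipschitz
  refine ⟨(1 / c + M * L / c ^ 2).toNNReal, LipschitzOnWith.of_dist_le_mul fun x hx y hy => ?_⟩
  refine le_trans ?_ (mul_le_mul_of_nonneg_right (Real.le_coe_toNNReal _) dist_nonneg)
  have hgx := hc.trans_le (hS x hx).2
  have hgy := hc.trans_le (hS y hy).2
  have hM : 0 ≤ M := (norm_nonneg x).trans (hS x hx).1
  have key : radialProj g x - radialProj g y =
      (g x)⁻¹ • (x - y) + ((g y - g x) * ((g x)⁻¹ * (g y)⁻¹)) • y := by
    rw [radialProj, radialProj, smul_sub, sub_add, ← sub_smul]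
    congr 2
    field_simp
    ring
  have hgL : |g y - g x| ≤ L * ‖x - y‖ := by
    have := hL.dist_le_mul y x
    rwa [Real.dist_eq, dist_comm, dist_eq_norm] at this
  have hix : (g x)⁻¹ ≤ c⁻¹ := inv_anti₀ hc (hS x hx).2
  have hiy : (g y)⁻¹ ≤ c⁻¹ := inv_anti₀ hc (hS y hy).2
  rw [dist_eq_norm, dist_eq_norm, key]
  refine (norm_add_le _ _).trans ?_
  rw [norm_smul, norm_smul, norm_mul, norm_mul, norm_inv, norm_inv, Real.norm_of_nonneg hgx.le,
    Real.norm_of_nonneg hgy.le, Real.norm_eq_abs]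
  calc (g x)⁻¹ * ‖x - y‖ + |g y - g x| * ((g x)⁻¹ * (g y)⁻¹) * ‖y‖
      ≤ c⁻¹ * ‖x - y‖ + L * ‖x - y‖ * (c⁻¹ * c⁻¹) * M := by
        gcongr
        exact (hS y hy).1
    _ = (1 / c + M * L / c ^ 2) * ‖x - y‖ := by field_simp

/-- Surface area is absolutely continuous with respect to the cone measure: near each of its points
the level set is a Lipschitz image of a hyperplane piece, under the radial projection. -/
theorem area_eq_zero_of_coneMeasure_eq_zero (hg : IsGauge g) {B : Set E} (hB : MeasurableSet B)
    (hB1 : B ⊆ g ⁻¹' {1}) (h0 : coneMeasure g B = 0) : μHE[finrank ℝ E - 1] B = 0 := by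
  obtain ⟨M, hM, hMg⟩ := hg.norm_le
  refine measure_null_of_locally_null _ fun x hx => ?_
  have hgx : g x = 1 := hB1 hx
  have hx0 : x ≠ 0 := by
    rintro rfl
    simp [hg.map_zero] at hgx
  have : Nontrivial E := ⟨x, 0, hx0⟩
  have hn : 0 < finrank ℝ E := finrank_pos
  have hxn : 0 < ‖x‖ := norm_pos_iff.2 hx0
  set v : E := (‖x‖ ^ 2)⁻¹ • x with hv
  have hvx : ⟪v, x⟫_ℝ = 1 := by
    rw [hv, real_inner_smul_left, real_inner_self_eq_norm_sq, inv_mul_cancel₀ (by positivity)]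
  have hv0 : v ≠ 0 := smul_ne_zero (by positivity) hx0
  have hvn : 0 < ‖v‖ := norm_pos_iff.2 hv0
  have hcont : Continuous fun z : E => ⟪v, z⟫_ℝ := by fun_prop
  set B' : Set E := B ∩ (fun z => ⟪v, z⟫_ℝ) ⁻¹' Ioi (1 / 2) with hB'
  have hB'm : MeasurableSet B' := hB.inter (hcont.measurable measurableSet_Ioi)
  refine ⟨B', inter_mem_nhdsWithin B (hcont.continuousAt.preimage_mem_nhds
    (Ioi_mem_nhds (by rw [hvx]; norm_num))), ?_⟩
  have hhalf : ∀ z ∈ B', 1 / 2 < ⟪v, z⟫_ℝ := fun z hz => hz.2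
  have hpos : ∀ z ∈ B', 0 < ⟪v, z⟫_ℝ := fun z hz => (by norm_num : (0 : ℝ) < 1 / 2).trans hz.2
  have hz1 : ∀ z ∈ B', g z = 1 := fun z hz => hB1 hz.1
  have hzM : ∀ z ∈ B', ‖z‖ ≤ M := fun z hz => by simpa [hz1 z hz] using hMg z
  set R : E → E := fun z => (⟪v, z⟫_ℝ)⁻¹ • z with hR
  have hπR : ∀ z ∈ B', radialProj g (R z) = z := fun z hz => by
    rw [hR, hg.radialProj_smul (inv_pos.2 (hpos z hz)), radialProj_of_eq_one (hz1 z hz)]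
  have hinj : InjOn R B' := fun z hz w hw hzw => by rw [← hπR z hz, ← hπR w hw, hzw]
  have hRc : ContinuousOn R B' :=
    (hcont.continuousOn.inv₀ fun z hz => (hpos z hz).ne').smul continuousOn_id
  have hRm : MeasurableSet (R '' B') := hB'm.image_of_continuousOn_injOn hRc hinj
  have hRv : ∀ z ∈ R '' B', ⟪v, z⟫_ℝ = 1 := by
    rintro _ ⟨z, hz, rfl⟩
    rw [hR, real_inner_smul_right, inv_mul_cancel₀ (hpos z hz).ne']
  have hvol : volume (coneOver B) = 0 := by
    rw [hg.coneMeasure_apply hB hB1, mul_eq_zero] at h0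
    exact h0.resolve_left (by simp [hn.ne'])
  have hvolR : volume (coneOver (R '' B')) = 0 := by
    have : volume (coneOver (R '' B')) ≤ ENNReal.ofReal 2 ^ finrank ℝ E * volume (coneOver B) := by
      refine volume_coneOver_le zero_le_two ?_
      rintro _ ⟨z, hz, rfl⟩
      refine ⟨_, ⟨inv_pos.2 (hpos z hz), ?_⟩, z, hz.1, rfl⟩
      exact inv_le_of_inv_le₀ two_pos (by simpa using (hhalf z hz).le)
    rw [hvol, mul_zero] at this
    exact le_antisymm this zero_le
  have hHR : μHE[finrank ℝ E - 1] (R '' B') = 0 := by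
    rw [← volume_coneOver_of_inner_eq_one hv0 hRm hRv, hvolR, mul_zero]
  obtain ⟨C, hC⟩ : ∃ C, LipschitzOnWith C (radialProj g) (R '' B') := by
    refine hg.lipschitzOnWith_radialProj (M := 2 * M) (c := (‖v‖ * M)⁻¹) (by positivity) ?_
    rintro _ ⟨z, hz, rfl⟩
    constructor
    · rw [hR, norm_smul, norm_inv, Real.norm_of_nonneg (hpos z hz).le]
      gcongr
      · exact inv_le_of_inv_le₀ two_pos (by simpa using (hhalf z hz).le)
      · exact hzM z hz
    · rw [hR, hg.map_smul _ (inv_nonneg.2 (hpos z hz).le), hz1 z hz, mul_one]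
      refine inv_anti₀ (hpos z hz) ((real_inner_le_norm _ _).trans ?_)
      gcongr
      exact hzM z hz
  have himg : radialProj g '' (R '' B') = B' := by
    rw [image_image]
    exact (image_congr hπR).trans (image_id' _)
  have := hC.euclideanHausdorffMeasure_image_le (finrank ℝ E - 1)
  rw [himg, hHR, mul_zero] at this
  exact le_antisymm this zero_le

omit [FiniteDimensional ℝ E] [MeasurableSpace E] [BorelSpace E] in
/-- Euler's identity keeps the derivative away from zero on the level set. -/
theorem one_le_mul_norm_fderiv (hg : IsGauge g) {M : ℝ} (hM : ∀ x, ‖x‖ ≤ M * g x) {x : E}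
    (hx : g x = 1) (h : DifferentiableAt ℝ g x) : 1 ≤ M * ‖fderiv ℝ g x‖ := by
  have h1 := hg.fderiv_apply_self h
  calc (1 : ℝ) = fderiv ℝ g x x := by rw [h1, hx]
    _ ≤ ‖fderiv ℝ g x‖ * ‖x‖ := (le_abs_self _).trans ((fderiv ℝ g x).le_opNorm x)
    _ ≤ ‖fderiv ℝ g x‖ * M := by
        gcongr
        simpa [hx] using hM x
    _ = _ := mul_comm _ _

/-- On a piece of the level set where the derivative of `g` is nearly constant and approximates `g`
well, the surface area and the cone measure weighted by the norm of the derivative nearly agree. -/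
theorem area_comparable_of_approx (hg : IsGauge g) {M η : ℝ} (hM : 0 < M)
    (hMg : ∀ x, ‖x‖ ≤ M * g x) (hη0 : 0 < η) (hη1 : η < 1) {θ : ℝ≥0}
    (hθ : (θ : ℝ) = (1 + η) / (1 - η)) {B : Set E} (hB : MeasurableSet B)
    (hB1 : ∀ x ∈ B, g x = 1 ∧ DifferentiableAt ℝ g x) {f' : E →L[ℝ] ℝ} (hf' : 1 ≤ M * ‖f'‖)
    (happrox : ∀ x ∈ B, ∀ y ∈ B, |g x - g y - f' (x - y)| * M ≤ η * (1 - η) * ‖x - y‖)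
    (hnear : ∀ x ∈ B, M * ‖fderiv ℝ g x - f'‖ ≤ η * (1 - η)) :
    μHE[finrank ℝ E - 1] B ≤ (θ : ℝ≥0∞) ^ (2 * finrank ℝ E + 1) *
        (coneMeasure g).withDensity (fun x => ‖fderiv ℝ g x‖ₑ) B ∧
      (coneMeasure g).withDensity (fun x => ‖fderiv ℝ g x‖ₑ) B ≤
        (θ : ℝ≥0∞) ^ (2 * finrank ℝ E + 1) * μHE[finrank ℝ E - 1] B := by
  have hη : 0 < 1 - η := by linarith
  have hηθ : 1 + η ≤ θ := by
    rw [hθ, le_div_iff₀ hη]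
    nlinarith
  have hηθ' : (θ : ℝ)⁻¹ ≤ 1 - η := by
    rw [hθ, inv_div, div_le_iff₀ (by linarith)]
    nlinarith
  have hθ1 : 1 ≤ θ := by
    have : (1 : ℝ) ≤ θ := by linarith
    exact_mod_cast this
  set a : E := (InnerProductSpace.toDual ℝ E).symm f' with ha
  have hinner : ∀ x, ⟪a, x⟫_ℝ = f' x := fun x => by
    rw [ha, InnerProductSpace.toDual_symm_apply]
  have hnorm : ‖a‖ = ‖f'‖ := by rw [ha, LinearIsometryEquiv.norm_map]
  have ha0 : a ≠ 0 := by
    intro h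
    rw [← hnorm, h, norm_zero, mul_zero] at hf'
    linarith
  have hηη : η * (1 - η) ≤ η := by nlinarith
  have hxM : ∀ x ∈ B, ‖x‖ ≤ M := fun x hx => by simpa [(hB1 x hx).1] using hMg x
  have hone : ∀ x ∈ B, |⟪a, x⟫_ℝ - 1| ≤ η := fun x hx => by
    have h1 : ⟪a, x⟫_ℝ - 1 = -((fderiv ℝ g x - f') x) := by
      rw [sub_apply, hg.fderiv_apply_self (hB1 x hx).2, (hB1 x hx).1, hinner]
      ring
    rw [h1, abs_neg]
    calc |(fderiv ℝ g x - f') x| ≤ ‖fderiv ℝ g x - f'‖ * ‖x‖ := (fderiv ℝ g x - f').le_opNorm x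
      _ ≤ ‖fderiv ℝ g x - f'‖ * M := by gcongr; exact hxM x hx
      _ ≤ η := by linarith [hnear x hx]
  have hcomp : ∀ x ∈ B, ∀ y ∈ B, _ := fun x hx y hy =>
    norm_inv_smul_sub_inv_smul_comparable hη0 hη1 (hone x hx) (hone y hy) (hxM y hy) (by
      have := happrox x hx y hy
      rwa [(hB1 x hx).1, (hB1 y hy).1, sub_self, zero_sub, abs_neg, map_sub, ← hinner,
        ← hinner] at this)
  obtain ⟨h1, h2⟩ := area_comparable_volume_coneOver ha0 hθ1 hB
    (fun x hx => by
      obtain ⟨h3, h4⟩ := abs_le.1 (hone x hx)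
      exact ⟨by linarith, by linarith⟩)
    (LipschitzOnWith.of_dist_le_mul fun x hx y hy => by
      rw [dist_eq_norm, dist_eq_norm, hθ]
      exact (hcomp x hx y hy).1)
    (fun x hx y hy => by
      rw [dist_eq_norm, dist_eq_norm, hθ]
      exact (hcomp x hx y hy).2)
  have hcone : finrank ℝ E * ‖a‖ₑ * volume (coneOver B) = ‖a‖ₑ * coneMeasure g B := by
    rw [hg.coneMeasure_apply hB fun x hx => (hB1 x hx).1]
    ring
  rw [hcone] at h1 h2
  have hdens : (coneMeasure g).withDensity (fun x => ‖fderiv ℝ g x‖ₑ) B =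
      ∫⁻ x in B, ‖fderiv ℝ g x‖ₑ ∂coneMeasure g := withDensity_apply _ hB
  have hofReal : ∀ s t : ℝ, 0 ≤ s → s ≤ θ * t → ENNReal.ofReal s ≤ θ * ENNReal.ofReal t :=
    fun s t hs hst => by
      rw [← ENNReal.ofReal_coe_nnreal, ← ENNReal.ofReal_mul θ.coe_nonneg]
      exact ENNReal.ofReal_le_ofReal hst
  have hbound : ∀ x ∈ B, ‖a‖ₑ ≤ θ * ‖fderiv ℝ g x‖ₑ ∧ ‖fderiv ℝ g x‖ₑ ≤ θ * ‖a‖ₑ := fun x hx => by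
    have h3 := hg.one_le_mul_norm_fderiv hMg (hB1 x hx).1 (hB1 x hx).2
    have h4 : |‖fderiv ℝ g x‖ - ‖f'‖| * M ≤ η := by
      calc |‖fderiv ℝ g x‖ - ‖f'‖| * M ≤ ‖fderiv ℝ g x - f'‖ * M := by
            gcongr
            exact abs_norm_sub_norm_le _ _
        _ ≤ η := by linarith [hnear x hx]
    obtain ⟨h5, h6⟩ := abs_le.1 (show |‖fderiv ℝ g x‖ - ‖f'‖| ≤ η / M by rwa [le_div_iff₀ hM])
    have h7 : η / M ≤ η * ‖fderiv ℝ g x‖ := by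
      rw [div_le_iff₀ hM]
      nlinarith
    have h8 : η / M ≤ η * ‖f'‖ := by
      rw [div_le_iff₀ hM]
      nlinarith
    rw [← ofReal_norm, ← ofReal_norm, hnorm]
    refine ⟨hofReal _ _ (norm_nonneg _) ?_, hofReal _ _ (norm_nonneg _) ?_⟩
    · nlinarith [norm_nonneg (fderiv ℝ g x)]
    · nlinarith [norm_nonneg f']
  have hm : Measurable fun x => ‖fderiv ℝ g x‖ₑ := (measurable_fderiv ℝ g).enorm
  have hd1 : ‖a‖ₑ * coneMeasure g B ≤ θ * ∫⁻ x in B, ‖fderiv ℝ g x‖ₑ ∂coneMeasure g := by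
    rw [← lintegral_const_mul _ hm, ← setLIntegral_const]
    exact setLIntegral_mono (hm.const_mul _) fun x hx => (hbound x hx).1
  have hd2 : ∫⁻ x in B, ‖fderiv ℝ g x‖ₑ ∂coneMeasure g ≤ θ * (‖a‖ₑ * coneMeasure g B) := by
    rw [← mul_assoc, ← setLIntegral_const]
    exact setLIntegral_mono measurable_const fun x hx => (hbound x hx).2
  -- `θ ^ (2 * n)` comes from the comparison with the cone, the last factor `θ` from the density.
  rw [hdens, pow_succ]
  constructor
  · refine h1.trans ?_
    rw [mul_assoc]
    gcongr
  · calc _ ≤ _ := hd2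
      _ ≤ θ * ((θ : ℝ≥0∞) ^ (2 * finrank ℝ E) * μHE[finrank ℝ E - 1] B) := by gcongr
      _ = _ := by ring

/-- The points of differentiability are cut into countably many nearly flat pieces: first by the value of
the derivative, then by the quality of the linear approximation. -/
theorem area_eq_of_differentiableAt (hg : IsGauge g) {B : Set E} (hB : MeasurableSet B)
    (hB1 : ∀ x ∈ B, g x = 1 ∧ DifferentiableAt ℝ g x) :
    μHE[finrank ℝ E - 1] B = (coneMeasure g).withDensity (fun x => ‖fderiv ℝ g x‖ₑ) B := by
  obtain ⟨M, hM, hMg⟩ := hg.norm_le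
  set ν := (coneMeasure g).withDensity (fun x => ‖fderiv ℝ g x‖ₑ) with hν
  suffices H : ∀ θ : ℝ≥0, 1 < θ →
      μHE[finrank ℝ E - 1] B ≤ ((θ : ℝ≥0∞) ^ (2 * finrank ℝ E + 1) • ν) B ∧
      ν B ≤ ((θ : ℝ≥0∞) ^ (2 * finrank ℝ E + 1) • μHE[finrank ℝ E - 1]) B from
    le_antisymm (ENNReal.le_of_forall_one_lt_le_pow_mul fun θ hθ => (H θ hθ).1)
      (ENNReal.le_of_forall_one_lt_le_pow_mul fun θ hθ => (H θ hθ).2)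
  intro θ hθ
  have hθ' : (1 : ℝ) < θ := by exact_mod_cast hθ
  -- the solution `η` of `(1 + η) / (1 - η) = θ`
  set η : ℝ := (θ - 1) / (θ + 1) with hη
  have hη0 : 0 < η := div_pos (by linarith) (by linarith)
  have hη1 : η < 1 := by rw [hη, div_lt_one (by linarith)]; linarith
  have hθη : (θ : ℝ) = (1 + η) / (1 - η) := by
    rw [hη]
    field_simp
    ring
  have h1η : 0 < 1 - η := by linarith
  set δ : ℝ := η * (1 - η) / (2 * M) with hδ
  have hδ0 : 0 < δ := by positivity
  -- On `S j` the derivative of `g` varies by less than `2 * δ`.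
  set q := TopologicalSpace.denseSeq (E →L[ℝ] ℝ) with hq
  set S : ℕ → Set E := fun j => fderiv ℝ g ⁻¹' Metric.ball (q j) δ with hS
  have hSm : ∀ j, MeasurableSet (S j) := fun j => measurable_fderiv ℝ g measurableSet_ball
  have hScov : ∀ x, ∃ j, x ∈ S j := fun x => by
    obtain ⟨_, h, j, rfl⟩ := Metric.dense_iff.1 (TopologicalSpace.denseRange_denseSeq (E →L[ℝ] ℝ))
      (fderiv ℝ g x) δ hδ0
    exact ⟨j, by rwa [hS, mem_preimage, Metric.mem_ball, dist_comm]⟩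
  have main : ∀ j, ∃ t : ℕ → Set E, (∀ k, MeasurableSet (t k)) ∧ B ∩ S j ⊆ ⋃ k, t k ∧
      ∀ k C, MeasurableSet C → C ⊆ B ∩ S j ∩ t k →
        μHE[finrank ℝ E - 1] C ≤ (θ : ℝ≥0∞) ^ (2 * finrank ℝ E + 1) * ν C ∧
        ν C ≤ (θ : ℝ≥0∞) ^ (2 * finrank ℝ E + 1) * μHE[finrank ℝ E - 1] C := by
    intro j
    obtain ⟨t, A, -, htm, htcov, htA, hA⟩ :=
      exists_partition_approximatesLinearOn_of_hasFDerivWithinAt g (B ∩ S j) (fderiv ℝ g)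
        (fun x hx => (hB1 x hx.1).2.hasFDerivAt.hasFDerivWithinAt) (fun _ => ⟨δ, hδ0.le⟩)
        (fun _ h => hδ0.ne' (congrArg NNReal.toReal h))
    refine ⟨t, htm, htcov, fun k C hC hCB => ?_⟩
    rcases C.eq_empty_or_nonempty with rfl | ⟨x₀, hx₀⟩
    · simp
    obtain ⟨y, hy, hAy⟩ := hA ⟨x₀, (hCB hx₀).1⟩ k
    refine hg.area_comparable_of_approx hM hMg hη0 hη1 hθη hC (fun x hx => hB1 x (hCB hx).1.1)
      (f' := A k) ?_ (fun x hx z hz => ?_) (fun x hx => ?_)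
    · rw [hAy]
      exact hg.one_le_mul_norm_fderiv hMg (hB1 y hy.1).1 (hB1 y hy.1).2
    · have h3 := htA k x (hCB hx) z (hCB hz)
      rw [Real.norm_eq_abs] at h3
      calc _ ≤ δ * ‖x - z‖ * M := by gcongr; exact h3
        _ = η * (1 - η) / 2 * ‖x - z‖ := by rw [hδ]; field_simp
        _ ≤ _ := by gcongr; exact half_le_self (by positivity)
    · have h4 : dist (fderiv ℝ g x) (fderiv ℝ g y) ≤ 2 * δ := by
        have h5 : dist (fderiv ℝ g x) (q j) < δ := (hCB hx).1.2
        have h6 : dist (fderiv ℝ g y) (q j) < δ := hy.2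
        linarith [dist_triangle_right (fderiv ℝ g x) (fderiv ℝ g y) (q j)]
      rw [hAy, ← dist_eq_norm]
      calc _ ≤ M * (2 * δ) := by gcongr
        _ = _ := by rw [hδ]; field_simp
  have hcovS : B ⊆ ⋃ j, S j := fun x _ => mem_iUnion.2 (hScov x)
  constructor
  · refine measure_le_of_countable_cover hSm hB hcovS fun j C hC hCj => ?_
    obtain ⟨t, htm, htcov, ht⟩ := main j
    refine measure_le_of_countable_cover htm hC (hCj.trans htcov) fun k D hD hDk => ?_
    exact (ht k D hD (hDk.trans (inter_subset_inter_left _ hCj))).1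
  · refine measure_le_of_countable_cover hSm hB hcovS fun j C hC hCj => ?_
    obtain ⟨t, htm, htcov, ht⟩ := main j
    refine measure_le_of_countable_cover htm hC (hCj.trans htcov) fun k D hD hDk => ?_
    exact (ht k D hD (hDk.trans (inter_subset_inter_left _ hCj))).2

theorem area_ae_differentiableAt (hg : IsGauge g) :
    ∀ᵐ x ∂(μHE[finrank ℝ E - 1] : Measure E).restrict (g ⁻¹' {1}),
      g x = 1 ∧ DifferentiableAt ℝ g x := by
  have hm1 : MeasurableSet (g ⁻¹' {1}) := hg.continuous.measurable (measurableSet_singleton 1)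
  have hm : MeasurableSet {x | DifferentiableAt ℝ g x} := measurableSet_of_differentiableAt ℝ g
  refine (ae_restrict_mem hm1).and ?_
  rw [ae_restrict_iff' hm1, ae_iff]
  have h := hg.area_eq_zero_of_coneMeasure_eq_zero (hm1.inter hm.compl) inter_subset_left
    (measure_mono_null (fun x hx (h : g x = 1 ∧ _) => hx.2 h.2) hg.ae_coneMeasure)
  refine measure_mono_null (fun x hx => ?_) h
  simpa using hx

/-- The surface area measure of the level set `{x | g x = 1}` has density `‖∇g‖` with respect to the
cone measure. -/
theorem area_eq_withDensity_coneMeasure (hg : IsGauge g) :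
    (μHE[finrank ℝ E - 1] : Measure E).restrict (g ⁻¹' {1}) =
      (coneMeasure g).withDensity fun x => ‖fderiv ℝ g x‖ₑ := by
  ext B hB
  have hm : MeasurableSet {x | g x = 1 ∧ DifferentiableAt ℝ g x} :=
    (hg.continuous.measurable (measurableSet_singleton 1)).inter
      (measurableSet_of_differentiableAt ℝ g)
  set D : Set E := {x | g x = 1 ∧ DifferentiableAt ℝ g x} with hD
  have h1 : (μHE[finrank ℝ E - 1] : Measure E).restrict (g ⁻¹' {1}) B =
      (μHE[finrank ℝ E - 1] : Measure E).restrict (g ⁻¹' {1}) (B ∩ D) :=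
    (measure_inter_conull hg.area_ae_differentiableAt).symm
  have h2 : (coneMeasure g).withDensity (fun x => ‖fderiv ℝ g x‖ₑ) B =
      (coneMeasure g).withDensity (fun x => ‖fderiv ℝ g x‖ₑ) (B ∩ D) :=
    (measure_inter_conull ((withDensity_absolutelyContinuous _ _).ae_le hg.ae_coneMeasure)).symm
  rw [h1, h2, Measure.restrict_apply (hB.inter hm),
    inter_eq_left.2 (show B ∩ D ⊆ g ⁻¹' {1} from fun x hx => hx.2.1)]
  exact hg.area_eq_of_differentiableAt (hB.inter hm) fun x hx => hx.2

/-- Integrals over the level set `{x | g x = 1}` with respect to surface area are integrals over the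
body `{x | 0 < g x ≤ 1}` in polar coordinates. -/
theorem setLIntegral_area (hg : IsGauge g) {F : E → ℝ≥0∞} (hF : Measurable F) :
    ∫⁻ x in g ⁻¹' {1}, F x ∂μHE[finrank ℝ E - 1] =
      finrank ℝ E * ∫⁻ z in g ⁻¹' Ioc 0 1, ‖fderiv ℝ g z‖ₑ * F (radialProj g z) := by
  have hm : Measurable fun x => ‖fderiv ℝ g x‖ₑ := (measurable_fderiv ℝ g).enorm
  rw [hg.area_eq_withDensity_coneMeasure, lintegral_withDensity_eq_lintegral_mul _ hm hF,
    coneMeasure, lintegral_smul_measure, lintegral_map (hm.mul hF) hg.measurable_radialProj,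
    smul_eq_mul]
  congr 1
  refine lintegral_congr_ae ?_
  rw [EventuallyEq, ae_restrict_iff' (hg.continuous.measurable measurableSet_Ioc)]
  refine Eventually.of_forall fun z hz1 => ?_
  have hz0 : z ≠ 0 := by
    rintro rfl
    simp [hg.map_zero] at hz1
  rw [Pi.mul_apply, hg.fderiv_radialProj hz0]

end IsGauge

/-! ### Integrals of homogeneous functions against a Gaussian of the gauge -/

namespace IsGauge

variable {g : E → ℝ}

/-- The integral of a `0`-homogeneous function over a sublevel set of `g` scales like the volume. -/
theorem setLIntegral_sublevel [Nontrivial E] (hg : IsGauge g) {F : E → ℝ≥0∞} (hF : Measurable F)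
    (hF1 : ∀ t : ℝ, 0 < t → ∀ z, F (t • z) = F z) {s : ℝ} (hs : 0 ≤ s) :
    ∫⁻ z in {z | g z ≤ s}, F z =
      ENNReal.ofReal (s ^ finrank ℝ E) * ∫⁻ z in {z | g z ≤ 1}, F z := by
  have hm : MeasurableSet {z | g z ≤ s} := measurableSet_le hg.continuous.measurable measurable_const
  rcases hs.eq_or_lt with rfl | hs
  · have h0 : {z : E | g z ≤ 0} ⊆ {0} := fun z hz => by
      by_contra h
      exact (hg.pos h).not_ge hz
    have hn : finrank ℝ E ≠ 0 := finrank_pos.ne'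
    rw [zero_pow hn, ENNReal.ofReal_zero, zero_mul]
    exact setLIntegral_measure_zero _ _ (measure_mono_null h0 (measure_singleton _))
  · have hsm : Measurable fun z : E => s • z := measurable_const_smul s
    have hmap : (volume : Measure E) =
        ENNReal.ofReal (s ^ finrank ℝ E) • Measure.map (fun z => s • z) volume := by
      rw [Measure.map_addHaar_smul _ hs.ne', smul_smul, ← ENNReal.ofReal_mul (by positivity),
        abs_of_pos (by positivity), mul_inv_cancel₀ (by positivity), ENNReal.ofReal_one, one_smul]
    conv_lhs => rw [hmap]
    rw [Measure.restrict_smul, lintegral_smul_measure, setLIntegral_map hm hF hsm, smul_eq_mul]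
    congr 1
    have hset : (fun z => s • z) ⁻¹' {z | g z ≤ s} = {z | g z ≤ 1} := by
      ext z
      simp only [mem_preimage, mem_ofPred_eq, hg.map_smul s hs.le]
      exact mul_le_iff_le_one_right hs
    rw [hset]
    exact lintegral_congr fun z => hF1 s hs z

/-- The layers of `exp (-g² / 2)` are sublevel sets of `g`, all of them dilates of each other. -/
theorem lintegral_mul_lintegral_exp [Nontrivial E] (hg : IsGauge g) {F : E → ℝ≥0∞}
    (hF : Measurable F) (hF1 : ∀ t : ℝ, 0 < t → ∀ z, F (t • z) = F z) :
    (∫⁻ z in {z | g z ≤ 1}, F z) * ∫⁻ z, ENNReal.ofReal (Real.exp (-(g z ^ 2 / 2))) =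
      volume {z | g z ≤ 1} * ∫⁻ z, F z * ENNReal.ofReal (Real.exp (-(g z ^ 2 / 2))) := by
  have hgm : Measurable g := hg.continuous.measurable
  have hfm : Measurable fun z => Real.exp (-(g z ^ 2 / 2)) := by fun_prop
  have hm : ∀ s : ℝ, MeasurableSet {z | g z ≤ s} := fun s => measurableSet_le hgm measurable_const
  have hlayer : ∀ t : ℝ, 0 < t → t ≤ 1 →
      {z | t ≤ Real.exp (-(g z ^ 2 / 2))} = {z | g z ≤ √(-(2 * Real.log t))} := by
    intro t ht ht1
    ext z
    rw [mem_ofPred_eq, mem_ofPred_eq, Real.le_sqrt (hg.nonneg z), ← Real.log_le_iff_le_exp ht]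
    · constructor <;> intro h <;> linarith
    · have := Real.log_nonpos ht.le ht1
      linarith
  have hempty : ∀ t : ℝ, 1 < t → {z | t ≤ Real.exp (-(g z ^ 2 / 2))} = ∅ := by
    intro t ht
    refine eq_empty_of_forall_notMem fun z hz => ht.not_ge (le_trans hz ?_)
    exact Real.exp_le_one_iff.2 (by have := sq_nonneg (g z); linarith)
  have hone := fun s (hs : 0 ≤ s) =>
    hg.setLIntegral_sublevel (F := fun _ => 1) measurable_const (fun _ _ _ => rfl) (s := s) hs
  simp only [setLIntegral_const, one_mul] at hone
  have key : ∀ t : ℝ, 0 < t →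
      (∫⁻ z in {z | g z ≤ 1}, F z) * volume {z | t ≤ Real.exp (-(g z ^ 2 / 2))} =
        volume {z | g z ≤ 1} * volume.withDensity F {z | t ≤ Real.exp (-(g z ^ 2 / 2))} := by
    intro t ht
    rcases le_or_gt t 1 with ht1 | ht1
    · rw [hlayer t ht ht1, withDensity_apply _ (hm _), hone _ (Real.sqrt_nonneg _),
        hg.setLIntegral_sublevel hF hF1 (Real.sqrt_nonneg _)]
      ring
    · rw [hempty t ht1, measure_empty, measure_empty, mul_zero, mul_zero]
  have hmeas : ∀ μ : Measure E, Measurable fun t : ℝ => μ {z | t ≤ Real.exp (-(g z ^ 2 / 2))} :=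
    fun μ => Antitone.measurable fun s t hst => measure_mono fun z hz => hst.trans hz
  have hnn : ∀ z, (0 : ℝ) ≤ Real.exp (-(g z ^ 2 / 2)) := fun z => (Real.exp_pos _).le
  have hdens : ∫⁻ z, F z * ENNReal.ofReal (Real.exp (-(g z ^ 2 / 2))) =
      ∫⁻ z, ENNReal.ofReal (Real.exp (-(g z ^ 2 / 2))) ∂volume.withDensity F :=
    (lintegral_withDensity_eq_lintegral_mul _ hF hfm.ennreal_ofReal).symm
  rw [hdens, lintegral_eq_lintegral_meas_le _ (Eventually.of_forall hnn) hfm.aemeasurable,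
    lintegral_eq_lintegral_meas_le _ (Eventually.of_forall hnn) hfm.aemeasurable,
    ← lintegral_const_mul _ (hmeas _), ← lintegral_const_mul _ (hmeas _)]
  exact setLIntegral_congr_fun measurableSet_Ioi fun t ht => key t ht

theorem integrable_exp (hg : IsGauge g) : Integrable fun z => Real.exp (-(g z ^ 2 / 2)) := by
  obtain ⟨M, hM, hMg⟩ := hg.norm_le
  have h1 : Integrable fun z : E => Real.exp (-(1 / (2 * M ^ 2)) * ‖z‖ ^ 2) := by
    refine .of_integral_ne_zero ?_
    rw [GaussianFourier.integral_rexp_neg_mul_sq_norm (by positivity)]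
    have := Real.pi_pos
    positivity
  refine h1.mono' (by have := hg.continuous; fun_prop) (Eventually.of_forall fun z => ?_)
  rw [Real.norm_of_nonneg (Real.exp_pos _).le, Real.exp_le_exp]
  have h2 : ‖z‖ ^ 2 ≤ (M * g z) ^ 2 := by
    gcongr
    exact hMg z
  rw [neg_mul, neg_le_neg_iff, div_mul_eq_mul_div, one_mul, div_le_div_iff₀ (by positivity) two_pos]
  linarith

end IsGauge

end

namespace LYZ

variable {n : ℕ} {K : Set (Space n)}

/-! ### Gauge and support function of a convex body -/

theorem isGauge_gauge (hc : Convex ℝ K) (hk : IsCompact K) (h0 : K ∈ 𝓝 0) : IsGauge (gauge K) where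
  lipschitz := hc.lipschitz_gauge h0
  map_smul t ht x := by rw [gauge_smul_of_nonneg ht, smul_eq_mul]
  norm_le := by
    obtain ⟨r, hr⟩ := hk.isBounded.subset_closedBall (0 : Space n)
    have hr' : K ⊆ Metric.closedBall 0 (max r 1) :=
      hr.trans (Metric.closedBall_subset_closedBall (le_max_left _ _))
    have h1 : 0 < max r 1 := lt_max_of_lt_right one_pos
    refine ⟨max r 1, h1, fun x => ?_⟩
    have := le_gauge_of_subset_closedBall (absorbent_nhds_zero h0) h1.le hr' (x := x)
    rwa [div_le_iff₀' h1] at this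

theorem gauge_le_one_iff (hc : Convex ℝ K) (hk : IsCompact K) (h0 : K ∈ 𝓝 0) {x : Space n} :
    gauge K x ≤ 1 ↔ x ∈ K := by
  rw [gauge_le_one_iff_mem_closure hc h0, hk.isClosed.closure_eq]

theorem frontier_eq_preimage_gauge (hc : Convex ℝ K) (h0 : K ∈ 𝓝 0) :
    frontier K = gauge K ⁻¹' {1} := by
  ext x
  exact (gauge_eq_one_iff_mem_frontier hc h0).symm

theorem bddAbove_inner_image (hk : IsCompact K) (u : Space n) :
    BddAbove ((fun y => ⟪u, y⟫_ℝ) '' K) :=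
  (hk.image (by fun_prop)).bddAbove

theorem inner_le_supportFun (hk : IsCompact K) (u : Space n) {y : Space n} (hy : y ∈ K) :
    ⟪u, y⟫_ℝ ≤ supportFun K u :=
  le_csSup (bddAbove_inner_image hk u) (mem_image_of_mem _ hy)

theorem exists_inner_eq_supportFun (hk : IsCompact K) (hne : K.Nonempty) (u : Space n) :
    ∃ y ∈ K, ⟪u, y⟫_ℝ = supportFun K u := by
  obtain ⟨y, hy, h⟩ := hk.exists_sSup_image_eq hne (f := fun y => ⟪u, y⟫_ℝ) (by fun_prop)
  exact ⟨y, hy, h.symm⟩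

theorem supportFun_le (hne : K.Nonempty) {u : Space n} {c : ℝ} (h : ∀ y ∈ K, ⟪u, y⟫_ℝ ≤ c) :
    supportFun K u ≤ c :=
  csSup_le (hne.image _) (by rintro _ ⟨y, hy, rfl⟩; exact h y hy)

theorem supportFun_nonneg (hk : IsCompact K) (h0 : K ∈ 𝓝 0) (u : Space n) : 0 ≤ supportFun K u := by
  simpa using inner_le_supportFun hk u (mem_of_mem_nhds h0)

theorem supportFun_smul (hk : IsCompact K) (hne : K.Nonempty) {t : ℝ} (ht : 0 ≤ t) (u : Space n) :
    supportFun K (t • u) = t * supportFun K u := by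
  apply le_antisymm
  · refine supportFun_le hne fun y hy => ?_
    rw [real_inner_smul_left]
    gcongr
    exact inner_le_supportFun hk u hy
  · obtain ⟨y, hy, h⟩ := exists_inner_eq_supportFun hk hne u
    rw [← h, ← real_inner_smul_left]
    exact inner_le_supportFun hk _ hy

theorem supportFun_pos (hk : IsCompact K) (h0 : K ∈ 𝓝 0) {u : Space n} (hu : u ≠ 0) :
    0 < supportFun K u := by
  have h1 : Tendsto (fun t : ℝ => t • u) (𝓝 0) (𝓝 0) := by
    simpa using (tendsto_id (x := 𝓝 (0 : ℝ))).smul_const u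
  obtain ⟨t, ht, ht0⟩ := (((h1.eventually h0).filter_mono nhdsWithin_le_nhds).and
    (self_mem_nhdsWithin : Ioi (0 : ℝ) ∈ 𝓝[>] 0)).exists
  refine lt_of_lt_of_le ?_ (inner_le_supportFun hk u ht)
  rw [real_inner_smul_right, real_inner_self_eq_norm_sq]
  have := norm_pos_iff.2 hu
  exact mul_pos ht0 (by positivity)

/-- The inequality between the gauge and the support function. -/
theorem inner_le_gauge_mul_supportFun (hc : Convex ℝ K) (hk : IsCompact K) (h0 : K ∈ 𝓝 0)
    (x u : Space n) : ⟪u, x⟫_ℝ ≤ gauge K x * supportFun K u := by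
  have hg := isGauge_gauge hc hk h0
  rcases eq_or_ne x 0 with rfl | hx
  · simp
  have h1 : radialProj (gauge K) x ∈ K := (gauge_le_one_iff hc hk h0).1 (hg.map_radialProj hx).le
  have h2 := inner_le_supportFun hk u h1
  rw [radialProj, real_inner_smul_right, inv_mul_le_iff₀ (hg.pos hx)] at h2
  exact h2

theorem convexOn_gauge (hc : Convex ℝ K) (h0 : K ∈ 𝓝 0) : ConvexOn ℝ univ (gauge K) := by
  refine ⟨convex_univ, fun x _ y _ a b ha hb _ => ?_⟩
  refine (gauge_add_le hc (absorbent_nhds_zero h0) _ _).trans_eq ?_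
  rw [gauge_smul_of_nonneg ha, gauge_smul_of_nonneg hb]

/-- By subadditivity, all derivatives of the gauge are dominated by the gauge. -/
theorem fderiv_gauge_apply_le (hc : Convex ℝ K) (h0 : K ∈ 𝓝 0) {z : Space n}
    (hz : DifferentiableAt ℝ (gauge K) z) (y : Space n) : fderiv ℝ (gauge K) z y ≤ gauge K y := by
  have h1 : HasDerivAt (fun t : ℝ => gauge K (z + t • y)) (fderiv ℝ (gauge K) z y) 0 := by
    have h2 : HasDerivAt (fun t : ℝ => z + t • y) y 0 := by
      simpa using ((hasDerivAt_id (0 : ℝ)).smul_const y).const_add z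
    have h3 : HasFDerivAt (gauge K) (fderiv ℝ (gauge K) z) (z + (0 : ℝ) • y) := by
      simpa using hz.hasFDerivAt
    exact h3.comp_hasDerivAt 0 h2
  have h4 := h1.tendsto_slope_zero_right
  refine le_of_tendsto h4 ?_
  filter_upwards [self_mem_nhdsWithin] with t ht
  have ht : 0 < t := ht
  simp only [zero_add, zero_smul, add_zero, smul_eq_mul]
  rw [inv_mul_le_iff₀ ht]
  have h5 := gauge_add_le hc (absorbent_nhds_zero h0) z (t • y)
  rw [gauge_smul_of_nonneg ht.le, smul_eq_mul] at h5
  linarith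

theorem inner_gradient {g : Space n → ℝ} (z y : Space n) :
    ⟪gradient g z, y⟫_ℝ = fderiv ℝ g z y := by
  rw [gradient, InnerProductSpace.toDual_symm_apply]

theorem norm_gradient {g : Space n → ℝ} (z : Space n) : ‖gradient g z‖ = ‖fderiv ℝ g z‖ := by
  rw [gradient, LinearIsometryEquiv.norm_map]

theorem gradient_gauge_ne_zero (hc : Convex ℝ K) (hk : IsCompact K) (h0 : K ∈ 𝓝 0) {z : Space n}
    (hz : DifferentiableAt ℝ (gauge K) z) (hz0 : z ≠ 0) : gradient (gauge K) z ≠ 0 := by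
  have hg := isGauge_gauge hc hk h0
  intro h
  have h1 := inner_gradient (g := gauge K) z z
  rw [h, inner_zero_left, hg.fderiv_apply_self hz] at h1
  exact (hg.pos hz0).ne h1

/-- The gradients of the gauge lie on the boundary of the polar body. -/
theorem supportFun_gradient_gauge (hc : Convex ℝ K) (hk : IsCompact K) (h0 : K ∈ 𝓝 0)
    {z : Space n} (hz : DifferentiableAt ℝ (gauge K) z) (hz0 : z ≠ 0) :
    supportFun K (gradient (gauge K) z) = 1 := by
  have hg := isGauge_gauge hc hk h0
  apply le_antisymm
  · refine supportFun_le ⟨0, mem_of_mem_nhds h0⟩ fun y hy => ?_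
    rw [inner_gradient]
    exact (fderiv_gauge_apply_le hc h0 hz y).trans ((gauge_le_one_iff hc hk h0).2 hy)
  · have h1 := inner_le_gauge_mul_supportFun hc hk h0 z (gradient (gauge K) z)
    rw [inner_gradient, hg.fderiv_apply_self hz] at h1
    exact (le_mul_iff_one_le_right (hg.pos hz0)).1 h1

/-! ### The outer normal -/

/-- At a boundary point where the gauge is differentiable, its normalized gradient is the only outer unit
normal. -/
theorem isOuterUnitNormal_iff (hc : Convex ℝ K) (hk : IsCompact K) (h0 : K ∈ 𝓝 0) {z : Space n}
    (hz : DifferentiableAt ℝ (gauge K) z) (hz1 : gauge K z = 1) {u : Space n} :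
    IsOuterUnitNormal K z u ↔ u = ‖gradient (gauge K) z‖⁻¹ • gradient (gauge K) z := by
  have hg := isGauge_gauge hc hk h0
  have hz0 : z ≠ 0 := by
    rintro rfl
    simp [hg.map_zero] at hz1
  have hgr := gradient_gauge_ne_zero hc hk h0 hz hz0
  set w := gradient (gauge K) z with hw
  have hwn : 0 < ‖w‖ := norm_pos_iff.2 hgr
  constructor
  · rintro ⟨hu1, hu⟩
    have hu0 : u ≠ 0 := by
      rintro rfl
      simp at hu1
    -- `x ↦ ⟪z, u⟫ * gauge K x - ⟪u, x⟫` is nonnegative and vanishes at `z`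
    have hsupp : supportFun K u = ⟪z, u⟫_ℝ :=
      le_antisymm (supportFun_le ⟨0, mem_of_mem_nhds h0⟩ fun y hy => by
        rw [real_inner_comm]; exact hu y hy)
        (by rw [real_inner_comm]
            exact inner_le_supportFun hk u ((gauge_le_one_iff hc hk h0).1 hz1.le))
    have hcpos : 0 < ⟪z, u⟫_ℝ := hsupp ▸ supportFun_pos hk h0 hu0
    have hmin : IsLocalMin (fun x => ⟪z, u⟫_ℝ * gauge K x - ⟪u, x⟫_ℝ) z := by
      refine Eventually.of_forall fun x => ?_
      have h1 := inner_le_gauge_mul_supportFun hc hk h0 x u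
      have h2 : ⟪u, z⟫_ℝ = ⟪z, u⟫_ℝ := real_inner_comm _ _
      rw [hsupp] at h1
      simp only [hz1, h2]
      linarith
    have hder : HasFDerivAt (fun x => ⟪z, u⟫_ℝ * gauge K x - ⟪u, x⟫_ℝ)
        (⟪z, u⟫_ℝ • fderiv ℝ (gauge K) z - innerSL ℝ u) z :=
      (hz.hasFDerivAt.const_mul _).sub (innerSL ℝ u).hasFDerivAt
    have hzero := hmin.hasFDerivAt_eq_zero hder
    have huw : u = ⟪z, u⟫_ℝ • w := by
      refine ext_inner_right ℝ fun y => ?_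
      have h3 := congrArg (fun f => f y) hzero
      simp only [sub_apply, smul_apply, innerSL_apply_apply, smul_eq_mul, zero_apply] at h3
      rw [real_inner_smul_left, hw, inner_gradient]
      linarith
    have hn : ⟪z, u⟫_ℝ * ‖w‖ = 1 := by
      have := congrArg norm huw
      rwa [norm_smul, Real.norm_of_nonneg hcpos.le, hu1, eq_comm] at this
    rw [eq_inv_of_mul_eq_one_left hn] at huw
    exact huw
  · rintro rfl
    refine ⟨?_, fun y hy => ?_⟩
    · rw [norm_smul, norm_inv, norm_norm, inv_mul_cancel₀ hwn.ne']
    · rw [real_inner_smul_right, real_inner_smul_right]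
      gcongr ‖w‖⁻¹ * ?_
      rw [real_inner_comm, hw, inner_gradient, real_inner_comm, inner_gradient,
        hg.fderiv_apply_self hz, hz1]
      exact (fderiv_gauge_apply_le hc h0 hz y).trans ((gauge_le_one_iff hc hk h0).2 hy)

theorem outerNormal_eq (hc : Convex ℝ K) (hk : IsCompact K) (h0 : K ∈ 𝓝 0) {z : Space n}
    (hz : DifferentiableAt ℝ (gauge K) z) (hz1 : gauge K z = 1) :
    outerNormal K z = ‖gradient (gauge K) z‖⁻¹ • gradient (gauge K) z := by
  have h : ∃! u, IsOuterUnitNormal K z u :=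
    ⟨_, (isOuterUnitNormal_iff hc hk h0 hz hz1).2 rfl,
      fun _ hu => (isOuterUnitNormal_iff hc hk h0 hz hz1).1 hu⟩
  rw [outerNormal, dif_pos h]
  exact (isOuterUnitNormal_iff hc hk h0 hz hz1).1 h.exists.choose_spec

theorem bodyIntegrand_eq (hc : Convex ℝ K) (hk : IsCompact K) (h0 : K ∈ 𝓝 0) {z : Space n}
    (hz : DifferentiableAt ℝ (gauge K) z) (hz1 : gauge K z = 1) (u : Space n) :
    bodyIntegrand K u z = fderiv ℝ (gauge K) z u ^ 2 * ‖fderiv ℝ (gauge K) z‖⁻¹ := by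
  have hz0 : z ≠ 0 := by
    rintro rfl
    simp [(isGauge_gauge hc hk h0).map_zero] at hz1
  have hw : 0 < ‖gradient (gauge K) z‖ := norm_pos_iff.2 (gradient_gauge_ne_zero hc hk h0 hz hz0)
  rw [bodyIntegrand, outerNormal_eq hc hk h0 hz hz1,
    supportFun_smul hk ⟨0, mem_of_mem_nhds h0⟩ (inv_nonneg.2 hw.le),
    supportFun_gradient_gauge hc hk h0 hz hz0, sq_abs, real_inner_smul_right, real_inner_comm,
    inner_gradient, ← norm_gradient]
  field_simp

/-! ### The quadratic form of the gradient of the gauge -/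

/-- The quadratic form `u ↦ ∫_K (u · ∇‖z‖_K)² dz`, to which both ellipsoids reduce. -/
noncomputable def gradientForm (K : Set (Space n)) (u : Space n) : ℝ :=
  ∫ z in K, fderiv ℝ (gauge K) z u ^ 2

theorem measurable_fderiv_apply_sq (g : Space n → ℝ) (u : Space n) :
    Measurable fun z => fderiv ℝ g z u ^ 2 :=
  (measurable_fderiv_apply_const ℝ g u).pow_const 2

theorem exists_fderiv_gauge_sq_le (hc : Convex ℝ K) (h0 : K ∈ 𝓝 0) (u : Space n) :
    ∃ C : ℝ, ∀ z, fderiv ℝ (gauge K) z u ^ 2 ≤ C := by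
  obtain ⟨L, hL⟩ := hc.lipschitz_gauge h0
  refine ⟨(L * ‖u‖) ^ 2, fun z => ?_⟩
  rw [sq_le_sq, abs_of_nonneg (a := L * ‖u‖) (by positivity)]
  exact ((fderiv ℝ (gauge K) z).le_opNorm u).trans
    (by gcongr; exact norm_fderiv_le_of_lipschitz ℝ hL)

theorem integrableOn_fderiv_gauge_sq (hc : Convex ℝ K) (hk : IsCompact K) (h0 : K ∈ 𝓝 0)
    (u : Space n) : IntegrableOn (fun z => fderiv ℝ (gauge K) z u ^ 2) K := by
  obtain ⟨C, hC⟩ := exists_fderiv_gauge_sq_le hc h0 u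
  refine Measure.integrableOn_of_bounded hk.measure_lt_top.ne
    (measurable_fderiv_apply_sq _ u).aestronglyMeasurable (M := C) (Eventually.of_forall fun z => ?_)
  rw [Real.norm_of_nonneg (sq_nonneg _)]
  exact hC z

theorem nontrivial_space (hn : 1 ≤ n) : Nontrivial (Space n) := by
  have : Nonempty (Fin n) := ⟨⟨0, hn⟩⟩
  infer_instance

theorem preimage_gauge_Ioc_ae_eq (hn : 1 ≤ n) (hc : Convex ℝ K) (hk : IsCompact K) (h0 : K ∈ 𝓝 0) :
    gauge K ⁻¹' Ioc 0 1 =ᵐ[volume] K := by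
  have := nontrivial_space hn
  have hg := isGauge_gauge hc hk h0
  filter_upwards [compl_mem_ae_iff.2 (measure_singleton (0 : Space n))] with z hz
  refine propext ⟨fun h => (gauge_le_one_iff hc hk h0).1 h.2, fun h => ?_⟩
  exact ⟨hg.pos hz, (gauge_le_one_iff hc hk h0).2 h⟩

theorem volume_real_pos (hk : IsCompact K) (h0 : K ∈ 𝓝 0) : 0 < volume.real K :=
  ENNReal.toReal_pos (Measure.measure_pos_of_mem_nhds volume h0).ne' hk.measure_lt_top.ne

theorem ae_frontier_bodyIntegrand_eq (hc : Convex ℝ K) (hk : IsCompact K) (h0 : K ∈ 𝓝 0)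
    (u : Space n) :
    ∀ᵐ z ∂(μHE[n - 1] : Measure (Space n)).restrict (frontier K),
      bodyIntegrand K u z = fderiv ℝ (gauge K) z u ^ 2 * ‖fderiv ℝ (gauge K) z‖⁻¹ := by
  have h := (isGauge_gauge hc hk h0).area_ae_differentiableAt
  rw [finrank_euclideanSpace_fin] at h
  rw [frontier_eq_preimage_gauge hc h0]
  filter_upwards [h] with z hz using bodyIntegrand_eq hc hk h0 hz.2 hz.1 u

theorem measurable_frontier_density (u : Space n) :
    Measurable fun z => fderiv ℝ (gauge K) z u ^ 2 * ‖fderiv ℝ (gauge K) z‖⁻¹ :=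
  (measurable_fderiv_apply_sq _ u).mul (measurable_fderiv ℝ _).norm.inv

theorem lintegral_frontier (hn : 1 ≤ n) (hc : Convex ℝ K) (hk : IsCompact K) (h0 : K ∈ 𝓝 0)
    (u : Space n) :
    ∫⁻ z in frontier K, ENNReal.ofReal (fderiv ℝ (gauge K) z u ^ 2 * ‖fderiv ℝ (gauge K) z‖⁻¹)
      ∂μHE[n - 1] = ENNReal.ofReal (n * gradientForm K u) := by
  have hg := isGauge_gauge hc hk h0
  have h := hg.setLIntegral_area (measurable_frontier_density (K := K) u).ennreal_ofReal
  rw [finrank_euclideanSpace_fin] at h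
  rw [frontier_eq_preimage_gauge hc h0, h, ENNReal.ofReal_mul (by positivity),
    ENNReal.ofReal_natCast, gradientForm,
    ofReal_integral_eq_lintegral_ofReal (integrableOn_fderiv_gauge_sq hc hk h0 u)
      (Eventually.of_forall fun z => sq_nonneg _),
    ← setLIntegral_congr (preimage_gauge_Ioc_ae_eq hn hc hk h0)]
  congr 1
  refine lintegral_congr_ae ?_
  rw [EventuallyEq, ae_restrict_iff' (hg.continuous.measurable measurableSet_Ioc)]
  filter_upwards [hg.ae_differentiableAt] with z hz hz1
  have hz0 : z ≠ 0 := by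
    rintro rfl
    simp [hg.map_zero] at hz1
  have hw : 0 < ‖fderiv ℝ (gauge K) z‖ := by
    rw [← norm_gradient]
    exact norm_pos_iff.2 (gradient_gauge_ne_zero hc hk h0 hz hz0)
  rw [hg.fderiv_radialProj hz0, ← ofReal_norm, ← ENNReal.ofReal_mul hw.le]
  congr 1
  field_simp

theorem integrableOn_bodyIntegrand (hn : 1 ≤ n) (hc : Convex ℝ K) (hk : IsCompact K)
    (h0 : K ∈ 𝓝 0) (u : Space n) :
    IntegrableOn (bodyIntegrand K u) (frontier K) μHE[n - 1] := by
  refine Integrable.congr ?_ ((ae_frontier_bodyIntegrand_eq hc hk h0 u).mono fun z hz => hz.symm)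
  refine ⟨(measurable_frontier_density u).aestronglyMeasurable, ?_⟩
  rw [hasFiniteIntegral_iff_ofReal (Eventually.of_forall fun z => by positivity),
    lintegral_frontier hn hc hk h0]
  exact ENNReal.ofReal_lt_top

theorem gradientForm_nonneg (u : Space n) : 0 ≤ gradientForm K u :=
  integral_nonneg fun _ => sq_nonneg _

/-- The form defining the LYZ ellipsoid of `K` as an integral over `K` instead of its boundary. -/
theorem bodyForm_eq (hn : 1 ≤ n) (hc : Convex ℝ K) (hk : IsCompact K) (h0 : K ∈ 𝓝 0)
    (u : Space n) : bodyForm K u = n / volume.real K * gradientForm K u := by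
  rw [bodyForm, integral_congr_ae (ae_frontier_bodyIntegrand_eq hc hk h0 u),
    integral_eq_lintegral_of_nonneg_ae (Eventually.of_forall fun z => by positivity)
      (measurable_frontier_density u).aestronglyMeasurable, lintegral_frontier hn hc hk h0,
    ENNReal.toReal_ofReal (mul_nonneg (by positivity) (gradientForm_nonneg u))]
  ring

/-- If the form vanished at `u`, then the gauge would not decrease in direction `-u`, and so would vanish at
small multiples of `u`. -/
theorem gradientForm_pos (hc : Convex ℝ K) (hk : IsCompact K) (h0 : K ∈ 𝓝 0) {u : Space n}
    (hu : u ≠ 0) : 0 < gradientForm K u := by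
  have hg := isGauge_gauge hc hk h0
  refine (gradientForm_nonneg u).lt_of_ne fun h => ?_
  have hae := (setIntegral_eq_zero_iff_of_nonneg_ae (Eventually.of_forall fun z => sq_nonneg _)
    (integrableOn_fderiv_gauge_sq hc hk h0 u)).1 h.symm
  rw [EventuallyEq, ae_restrict_iff' hk.measurableSet] at hae
  obtain ⟨t, ht, ht0⟩ : ∃ t : ℝ, t • u ∈ interior K ∧ 0 < t := by
    have h1 : Tendsto (fun t : ℝ => t • u) (𝓝 0) (𝓝 0) := by
      simpa using (tendsto_id (x := 𝓝 (0 : ℝ))).smul_const u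
    exact (((h1.eventually (interior_mem_nhds.2 h0)).filter_mono nhdsWithin_le_nhds).and
      (self_mem_nhdsWithin : Ioi (0 : ℝ) ∈ 𝓝[>] 0)).exists
  -- where the derivative in direction `u` vanishes, the gauge does not decrease in direction `-u`
  have hle : ∀ᵐ z, z ∈ K → gauge K z ≤ gauge K (z - t • u) := by
    filter_upwards [hae, hg.ae_differentiableAt] with z h1 h2 h3
    have h4 := fderiv_gauge_apply_le hc h0 h2 (z - t • u)
    have h5 : fderiv ℝ (gauge K) z u = 0 := by simpa using h1 h3
    rwa [map_sub, map_smul, h5, smul_zero, sub_zero, hg.fderiv_apply_self h2] at h4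
  set U : Set (Space n) := interior K ∩ {z | gauge K (z - t • u) < gauge K z} with hU
  have hUo : IsOpen U := isOpen_interior.inter
    (isOpen_lt (hg.continuous.comp (by fun_prop)) hg.continuous)
  have hUne : t • u ∈ U := ⟨ht, by
    simpa [hg.map_zero] using hg.pos (smul_ne_zero ht0.ne' hu)⟩
  refine (hUo.measure_pos volume ⟨_, hUne⟩).ne' (measure_mono_null (fun z hz => ?_) hle)
  exact fun h6 => (h6 (interior_subset hz.1)).not_gt hz.2

theorem gradientForm_smul (t : ℝ) (u : Space n) :
    gradientForm K (t • u) = t ^ 2 * gradientForm K u := by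
  simp_rw [gradientForm, map_smul, smul_eq_mul, mul_pow]
  exact integral_const_mul _ _

theorem bodyForm_pos (hn : 1 ≤ n) (hc : Convex ℝ K) (hk : IsCompact K) (h0 : K ∈ 𝓝 0)
    {u : Space n} (hu : u ≠ 0) : 0 < bodyForm K u := by
  rw [bodyForm_eq hn hc hk h0]
  have h1 := gradientForm_pos hc hk h0 hu
  have h2 := volume_real_pos hk h0
  have h3 : (0 : ℝ) < n := by exact_mod_cast hn
  positivity

theorem bodyForm_smul (hn : 1 ≤ n) (hc : Convex ℝ K) (hk : IsCompact K) (h0 : K ∈ 𝓝 0)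
    (t : ℝ) (u : Space n) : bodyForm K (t • u) = t ^ 2 * bodyForm K u := by
  rw [bodyForm_eq hn hc hk h0, bodyForm_eq hn hc hk h0, gradientForm_smul]
  ring

/-- The LYZ ellipsoid of `K` is the unit ball of the quadratic form `bodyForm K`. -/
theorem mem_bodyEllipsoid_iff (hn : 1 ≤ n) (hc : Convex ℝ K) (hk : IsCompact K) (h0 : K ∈ 𝓝 0)
    {x : Space n} : x ∈ bodyEllipsoid K ↔ bodyForm K x ≤ 1 := by
  constructor
  · rintro ⟨u, hu, r, hr, hru, rfl⟩
    have hu0 : u ≠ 0 := norm_ne_zero_iff.1 (by rw [hu]; exact one_ne_zero)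
    have hpos := bodyForm_pos hn hc hk h0 hu0
    rw [bodyRadial, le_div_iff₀ (Real.sqrt_pos.2 hpos)] at hru
    rw [bodyForm_smul hn hc hk h0, ← Real.sq_sqrt hpos.le, ← mul_pow]
    exact pow_le_one₀ (by positivity) hru
  · intro h
    rcases eq_or_ne x 0 with rfl | hx
    · have := nontrivial_space hn
      obtain ⟨u, hu⟩ := exists_norm_eq (Space n) zero_le_one
      exact ⟨u, hu, 0, le_rfl, by rw [bodyRadial]; positivity, by simp⟩
    have hxn : 0 < ‖x‖ := norm_pos_iff.2 hx
    have hpos := bodyForm_pos hn hc hk h0 hx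
    refine ⟨‖x‖⁻¹ • x, by rw [norm_smul, norm_inv, norm_norm, inv_mul_cancel₀ hxn.ne'], ‖x‖,
      hxn.le, ?_, by rw [smul_smul, mul_inv_cancel₀ hxn.ne', one_smul]⟩
    rw [bodyRadial, bodyForm_smul hn hc hk h0, Real.sqrt_mul (by positivity),
      Real.sqrt_sq (by positivity), le_div_iff₀ (by have := Real.sqrt_pos.2 hpos; positivity),
      mul_inv_cancel_left₀ hxn.ne']
    exact Real.sqrt_le_one.2 h

theorem gauge_bodyEllipsoid_sq (hn : 1 ≤ n) (hc : Convex ℝ K) (hk : IsCompact K) (h0 : K ∈ 𝓝 0)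
    (x : Space n) : gauge (bodyEllipsoid K) x ^ 2 = bodyForm K x := by
  rcases eq_or_ne x 0 with rfl | hx
  · have := bodyForm_smul hn hc hk h0 0 0
    rw [zero_smul, zero_pow two_ne_zero, zero_mul] at this
    rw [gauge_zero, this, zero_pow two_ne_zero]
  have hpos := bodyForm_pos hn hc hk h0 hx
  have hs := Real.sqrt_pos.2 hpos
  have hset : {r ∈ Ioi (0 : ℝ) | r⁻¹ • x ∈ bodyEllipsoid K} = Ici √(bodyForm K x) := by
    ext r
    rw [mem_ofPred_eq, mem_bodyEllipsoid_iff hn hc hk h0, bodyForm_smul hn hc hk h0, mem_Ici,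
      mem_Ioi]
    constructor
    · rintro ⟨hr, h⟩
      rw [inv_pow, inv_mul_le_iff₀ (by positivity), mul_one] at h
      exact (Real.sqrt_le_left hr.le).2 h
    · intro h
      have hr := hs.trans_le h
      refine ⟨hr, ?_⟩
      rw [inv_pow, inv_mul_le_iff₀ (by positivity), mul_one]
      exact (Real.sqrt_le_left hr.le).1 h
  rw [gauge_def', hset, csInf_Ici, Real.sq_sqrt hpos.le]

/-! ### The log-concave function of a convex body -/

theorem mass_expNegGauge_pos (hc : Convex ℝ K) (hk : IsCompact K) (h0 : K ∈ 𝓝 0) :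
    0 < mass (expNegGauge K) :=
  integral_exp_pos (isGauge_gauge hc hk h0).integrable_exp

theorem isLC_expNegGauge (hc : Convex ℝ K) (hk : IsCompact K) (h0 : K ∈ 𝓝 0) :
    IsLC (expNegGauge K) where
  pos _ := Real.exp_pos _
  logConcave := by
    have h1 : ConvexOn ℝ univ (fun x => (1 / 2 : ℝ) • (gauge K ^ 2) x) :=
      ((convexOn_gauge hc h0).pow (fun x _ => gauge_nonneg x) 2).smul (by norm_num)
    have h2 : (fun x => Real.log (expNegGauge K x)) = -fun x => (1 / 2 : ℝ) • (gauge K ^ 2) x := by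
      ext x
      simp only [expNegGauge, Real.log_exp, Pi.neg_apply, Pi.pow_apply, smul_eq_mul]
      ring
    rw [h2]
    exact h1.neg
  upperSemicontinuous := by
    have h1 : Continuous (expNegGauge K) := by
      have := (isGauge_gauge hc hk h0).continuous
      unfold expNegGauge
      fun_prop
    exact h1.upperSemicontinuous
  integrable := (isGauge_gauge hc hk h0).integrable_exp
  mass_pos := mass_expNegGauge_pos hc hk h0

theorem potential_exp (φ : Space n → ℝ) (x : Space n) :
    potential (fun x => Real.exp (-φ x)) x = (φ x : EReal) := by
  rw [potential, ENNReal.log_ofReal, if_neg (Real.exp_pos _).not_ge, Real.log_exp, EReal.coe_neg,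
    neg_neg]

theorem potential_expNegGauge (x : Space n) :
    potential (expNegGauge K) x = ((gauge K x ^ 2 / 2 : ℝ) : EReal) :=
  potential_exp (fun x => gauge K x ^ 2 / 2) x

/-- A Legendre transform with finite values, given by an attained upper bound. -/
theorem legendre_coe_eq {φ : Space n → ℝ} {y : Space n} {c : ℝ} (h1 : ∀ x, ⟪x, y⟫_ℝ - φ x ≤ c)
    (h2 : ∃ x, ⟪x, y⟫_ℝ - φ x = c) : legendre (fun x => (φ x : EReal)) y = (c : EReal) := by
  simp_rw [legendre, ← EReal.coe_sub]
  apply le_antisymm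
  · exact iSup_le fun x => EReal.coe_le_coe_iff.2 (h1 x)
  · obtain ⟨x, hx⟩ := h2
    rw [← hx]
    exact le_iSup (fun x => ((⟪x, y⟫_ℝ - φ x : ℝ) : EReal)) x

theorem legendre_potential_expNegGauge (hc : Convex ℝ K) (hk : IsCompact K) (h0 : K ∈ 𝓝 0)
    (y : Space n) :
    legendre (potential (expNegGauge K)) y = ((supportFun K y ^ 2 / 2 : ℝ) : EReal) := by
  rw [show potential (expNegGauge K) = fun x => ((gauge K x ^ 2 / 2 : ℝ) : EReal) from
    funext potential_expNegGauge]
  refine legendre_coe_eq (fun x => ?_) ?_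
  · have h1 := inner_le_gauge_mul_supportFun hc hk h0 x y
    rw [real_inner_comm] at h1
    nlinarith [sq_nonneg (gauge K x - supportFun K y)]
  · -- the supremum is attained at a multiple of the point of `K` farthest in direction `y`
    obtain ⟨z, hz, hzy⟩ := exists_inner_eq_supportFun hk ⟨0, mem_of_mem_nhds h0⟩ y
    have hh := supportFun_nonneg hk h0 y
    have hgz : gauge K z ≤ 1 := gauge_le_one_of_mem hz
    have h1 := inner_le_gauge_mul_supportFun hc hk h0 z y
    have h2 : supportFun K y * gauge K z = supportFun K y := by
      nlinarith
    refine ⟨supportFun K y • z, ?_⟩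
    rw [real_inner_smul_left, real_inner_comm, hzy, gauge_smul_of_nonneg hh, smul_eq_mul, h2]
    ring

theorem legendre_potential_expNegGauge_pos (hc : Convex ℝ K) (hk : IsCompact K) (h0 : K ∈ 𝓝 0)
    {y : Space n} (hy : y ≠ 0) : 0 < legendre (potential (expNegGauge K)) y := by
  rw [legendre_potential_expNegGauge hc hk h0, EReal.coe_pos]
  have := supportFun_pos hk h0 hy
  positivity

/-- Every point is paired with a supporting direction of `K`, by the Hahn–Banach theorem. -/
theorem exists_supportFun_eq_one (hc : Convex ℝ K) (hk : IsCompact K) (h0 : K ∈ 𝓝 0)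
    {x : Space n} (hx : x ≠ 0) : ∃ u, supportFun K u = 1 ∧ ⟪u, x⟫_ℝ = gauge K x := by
  have hg := isGauge_gauge hc hk h0
  have hx1 := hg.map_radialProj hx
  have hxg : gauge K x • radialProj (gauge K) x = x := by
    rw [radialProj, smul_smul, mul_inv_cancel₀ (hg.pos hx).ne', one_smul]
  set p := radialProj (gauge K) x with hp
  have hpint : p ∉ interior K := fun h => hx1.not_lt ((gauge_lt_one_iff_mem_interior hc h0).2 h)
  obtain ⟨f, hf⟩ := geometric_hahn_banach_open_point hc.interior isOpen_interior hpint
  have hfp : 0 < f p := by simpa using hf 0 (mem_interior_iff_mem_nhds.2 h0)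
  have hfK : ∀ y ∈ K, f y ≤ f p := by
    have hcl : K ⊆ closure (interior K) := by
      rw [hc.closure_interior_eq_closure_of_nonempty_interior
        ⟨0, mem_interior_iff_mem_nhds.2 h0⟩]
      exact subset_closure
    exact fun y hy => closure_minimal (fun y hy => (hf y hy).le)
      (isClosed_le f.continuous continuous_const) (hcl hy)
  set u := (f p)⁻¹ • (InnerProductSpace.toDual ℝ (Space n)).symm f with hu
  have hinner : ∀ y, ⟪u, y⟫_ℝ = (f p)⁻¹ * f y := fun y => by
    rw [hu, real_inner_smul_left, InnerProductSpace.toDual_symm_apply]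
  have hup : ⟪u, p⟫_ℝ = 1 := by rw [hinner, inv_mul_cancel₀ hfp.ne']
  refine ⟨u, le_antisymm (supportFun_le ⟨0, mem_of_mem_nhds h0⟩ fun y hy => ?_) ?_, ?_⟩
  · rw [hinner, inv_mul_le_iff₀ hfp, mul_one]
    exact hfK y hy
  · rw [← hup]
    exact inner_le_supportFun hk u ((gauge_le_one_iff hc hk h0).1 hx1.le)
  · conv_lhs => rw [← hxg, real_inner_smul_right, hup, mul_one]

/-- The sum has base function `(1 + t) h_K² / 2`, whose Legendre transform is
`‖x‖_K² / (2 (1 + t))` by duality between the gauge and the support function. -/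
theorem asplundSum_expNegGauge (hc : Convex ℝ K) (hk : IsCompact K) (h0 : K ∈ 𝓝 0) {t : ℝ}
    (ht : 0 < t) (x : Space n) :
    asplundSum 1 (expNegGauge K) t (expNegGauge K) x =
      Real.exp (-(gauge K x ^ 2 / (2 * (1 + t)))) := by
  have hg := isGauge_gauge hc hk h0
  have h1 : legendre (fun y => ((1 : ℝ) : EReal) * legendre (potential (expNegGauge K)) y +
      (t : EReal) * legendre (potential (expNegGauge K)) y) x =
        ((gauge K x ^ 2 / (2 * (1 + t)) : ℝ) : EReal) := by
    simp_rw [legendre_potential_expNegGauge hc hk h0, ← EReal.coe_mul, ← EReal.coe_add]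
    refine legendre_coe_eq (fun y => ?_) ?_
    · have h2 := inner_le_gauge_mul_supportFun hc hk h0 x y
      have h3 : gauge K x * supportFun K y - (1 + t) * (supportFun K y ^ 2 / 2) ≤
          gauge K x ^ 2 / (2 * (1 + t)) := by
        rw [le_div_iff₀ (by positivity)]
        nlinarith [sq_nonneg (gauge K x - (1 + t) * supportFun K y)]
      linarith
    · rcases eq_or_ne x 0 with rfl | hx
      · refine ⟨0, ?_⟩
        have := supportFun_smul hk ⟨0, mem_of_mem_nhds h0⟩ le_rfl (0 : Space n)
        rw [zero_smul, zero_mul] at this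
        simp [this]
      · obtain ⟨u, hu1, hu⟩ := exists_supportFun_eq_one hc hk h0 hx
        have h4 : 0 ≤ gauge K x / (1 + t) := div_nonneg (gauge_nonneg x) (by linarith)
        -- the multiple of `u` at which `g h - (1 + t) h² / 2` is maximal, where `g = gauge K x`
        refine ⟨(gauge K x / (1 + t)) • u, ?_⟩
        rw [real_inner_smul_left, hu, supportFun_smul hk ⟨0, mem_of_mem_nhds h0⟩ h4, hu1]
        field_simp
        ring
  rw [asplundSum, expNeg, h1, ← EReal.coe_neg, EReal.exp_coe, ENNReal.toReal_ofReal
    (Real.exp_pos _).le]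

theorem mass_asplundSum_expNegGauge (hc : Convex ℝ K) (hk : IsCompact K) (h0 : K ∈ 𝓝 0) {t : ℝ}
    (ht : 0 < t) : mass (asplundSum 1 (expNegGauge K) t (expNegGauge K)) =
      √(1 + t) ^ n * mass (expNegGauge K) := by
  have hs : 0 < √(1 + t) := Real.sqrt_pos.2 (by linarith)
  have h1 : ∀ x, asplundSum 1 (expNegGauge K) t (expNegGauge K) x =
      expNegGauge K ((√(1 + t))⁻¹ • x) := fun x => by
    rw [asplundSum_expNegGauge hc hk h0 ht, expNegGauge, gauge_smul_of_nonneg (by positivity),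
      smul_eq_mul, mul_pow, inv_pow, Real.sq_sqrt (by linarith)]
    congr 2
    field_simp
  simp_rw [mass, h1]
  rw [Measure.integral_comp_smul, finrank_euclideanSpace_fin, smul_eq_mul, inv_pow, inv_inv,
    abs_of_pos (by positivity)]

theorem tendsto_massQuotient_expNegGauge (hc : Convex ℝ K) (hk : IsCompact K) (h0 : K ∈ 𝓝 0) :
    Tendsto (massQuotient (expNegGauge K) (expNegGauge K)) (𝓝[>] 0)
      (𝓝 (n / 2 * mass (expNegGauge K))) := by
  have h1 : HasDerivAt (fun t : ℝ => √(1 + t) ^ n) (n / 2 : ℝ) 0 := by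
    have h2 : HasDerivAt (fun t : ℝ => 1 + t) 1 0 := (hasDerivAt_id _).const_add 1
    have h3 := (h2.sqrt (by norm_num)).pow n
    convert! h3 using 1
    simp [div_eq_mul_inv]
  refine (h1.tendsto_slope_zero_right.mul_const (mass (expNegGauge K))).congr' ?_
  filter_upwards [self_mem_nhdsWithin] with t ht
  rw [massQuotient, mass_asplundSum_expNegGauge hc hk h0 ht]
  simp only [zero_add, add_zero, Real.sqrt_one, one_pow, smul_eq_mul]
  ring

theorem firstVariation_expNegGauge (hc : Convex ℝ K) (hk : IsCompact K) (h0 : K ∈ 𝓝 0) :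
    firstVariation (expNegGauge K) (expNegGauge K) = n / 2 * mass (expNegGauge K) :=
  (tendsto_massQuotient_expNegGauge hc hk h0).limUnder_eq

/-! ### The integral against the surface area measure -/

theorem continuous_supportFun (hk : IsCompact K) (h0 : K ∈ 𝓝 0) : Continuous (supportFun K) := by
  obtain ⟨r, hr⟩ := hk.isBounded.exists_norm_le
  have hr0 : 0 ≤ r := (norm_nonneg _).trans (hr 0 (mem_of_mem_nhds h0))
  refine (LipschitzWith.of_le_add_mul ⟨r, hr0⟩ fun u v => ?_).continuous
  refine supportFun_le ⟨0, mem_of_mem_nhds h0⟩ fun y hy => ?_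
  have h1 : ⟪u, y⟫_ℝ = ⟪v, y⟫_ℝ + ⟪u - v, y⟫_ℝ := by rw [inner_sub_left]; ring
  rw [h1, dist_eq_norm]
  refine add_le_add (inner_le_supportFun hk v hy) ((real_inner_le_norm _ _).trans ?_)
  rw [mul_comm]
  change _ ≤ r * _
  gcongr
  exact hr y hy

theorem funIntegrand_expNegGauge (hc : Convex ℝ K) (hk : IsCompact K) (h0 : K ∈ 𝓝 0)
    (x y : Space n) :
    funIntegrand (expNegGauge K) x y = ⟪x, y⟫_ℝ ^ 2 * (supportFun K y ^ 2 / 2)⁻¹ := by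
  rw [funIntegrand, legendre_potential_expNegGauge hc hk h0, ← EReal.coe_inv, EReal.toReal_coe,
    sq_abs]

theorem measurable_funIntegrand_expNegGauge (hc : Convex ℝ K) (hk : IsCompact K) (h0 : K ∈ 𝓝 0)
    (x : Space n) : Measurable (funIntegrand (expNegGauge K) x) := by
  rw [funext (funIntegrand_expNegGauge hc hk h0 x)]
  have := (continuous_supportFun hk h0).measurable
  fun_prop

theorem gradient_potential_expNegGauge {z : Space n} (hz : DifferentiableAt ℝ (gauge K) z) :
    gradient (fun x => (potential (expNegGauge K) x).toReal) z =
      gauge K z • gradient (gauge K) z := by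
  simp_rw [potential_expNegGauge, EReal.toReal_coe]
  have h1 : HasFDerivAt (fun x => gauge K x ^ 2 / 2) (gauge K z • fderiv ℝ (gauge K) z) z := by
    have h2 := (hz.hasFDerivAt.pow 2).mul_const (1 / 2)
    simp only [← div_eq_mul_one_div] at h2
    convert! h2 using 1
    ext x
    simp
    ring
  rw [gradient, h1.fderiv, map_smul, gradient]

theorem measurable_gradient (φ : Space n → ℝ) : Measurable (gradient φ) :=
  (InnerProductSpace.toDual ℝ (Space n)).symm.continuous.measurable.comp (measurable_fderiv ℝ φ)

/-- Since `∇(‖z‖_K² / 2) = ‖z‖_K ∇‖z‖_K` and `h_K(∇‖z‖_K) = 1`, the factors `‖z‖_K²` cancel. -/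
theorem ae_funIntegrand_gradient_eq (hn : 1 ≤ n) (hc : Convex ℝ K) (hk : IsCompact K)
    (h0 : K ∈ 𝓝 0) (x : Space n) :
    ∀ᵐ z, funIntegrand (expNegGauge K) x
        (gradient (fun x => (potential (expNegGauge K) x).toReal) z) =
      2 * fderiv ℝ (gauge K) z x ^ 2 := by
  have := nontrivial_space hn
  have hg := isGauge_gauge hc hk h0
  filter_upwards [hg.ae_differentiableAt, compl_mem_ae_iff.2 (measure_singleton (0 : Space n))]
    with z hz hz0
  have hgz := hg.pos hz0
  rw [gradient_potential_expNegGauge hz, funIntegrand_expNegGauge hc hk h0,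
    supportFun_smul hk ⟨0, mem_of_mem_nhds h0⟩ hgz.le, supportFun_gradient_gauge hc hk h0 hz hz0,
    real_inner_smul_right, real_inner_comm, inner_gradient]
  field_simp

theorem integrable_fderiv_gauge_sq_mul (hc : Convex ℝ K) (hk : IsCompact K) (h0 : K ∈ 𝓝 0)
    (x : Space n) : Integrable fun z => fderiv ℝ (gauge K) z x ^ 2 * expNegGauge K z := by
  obtain ⟨C, hC⟩ := exists_fderiv_gauge_sq_le hc h0 x
  refine (isGauge_gauge hc hk h0).integrable_exp.bdd_mul (c := C)
    (measurable_fderiv_apply_sq _ x).aestronglyMeasurable (Eventually.of_forall fun z => ?_)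
  rw [Real.norm_of_nonneg (sq_nonneg _)]
  exact hC z

theorem integral_fderiv_gauge_sq_mul (hn : 1 ≤ n) (hc : Convex ℝ K) (hk : IsCompact K)
    (h0 : K ∈ 𝓝 0) (x : Space n) :
    ∫ z, fderiv ℝ (gauge K) z x ^ 2 * expNegGauge K z =
      mass (expNegGauge K) / volume.real K * gradientForm K x := by
  have := nontrivial_space hn
  have hg := isGauge_gauge hc hk h0
  have hset : {z | gauge K z ≤ 1} = K := by
    ext z
    exact gauge_le_one_iff hc hk h0
  have h1 := hg.lintegral_mul_lintegral_exp (F := fun z => ENNReal.ofReal (fderiv ℝ (gauge K) z x ^ 2))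
    (measurable_fderiv_apply_sq _ x).ennreal_ofReal (fun t ht z => by rw [hg.fderiv_smul z ht])
  simp_rw [← ENNReal.ofReal_mul (sq_nonneg (fderiv ℝ (gauge K) _ x))] at h1
  change _ * ∫⁻ z, ENNReal.ofReal (expNegGauge K z) =
    _ * ∫⁻ z, ENNReal.ofReal (fderiv ℝ (gauge K) z x ^ 2 * expNegGauge K z) at h1
  rw [hset, ← ofReal_integral_eq_lintegral_ofReal (integrableOn_fderiv_gauge_sq hc hk h0 x)
      (Eventually.of_forall fun z => sq_nonneg _),
    ← ofReal_integral_eq_lintegral_ofReal (isLC_expNegGauge hc hk h0).integrable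
      (Eventually.of_forall fun z => (Real.exp_pos _).le),
    ← ofReal_integral_eq_lintegral_ofReal (integrable_fderiv_gauge_sq_mul hc hk h0 x)
      (Eventually.of_forall fun z => mul_nonneg (sq_nonneg _) (Real.exp_pos _).le)] at h1
  have h2 := congrArg ENNReal.toReal h1
  have hQ : 0 ≤ ∫ z in K, fderiv ℝ (gauge K) z x ^ 2 := gradientForm_nonneg x
  have hJ : 0 ≤ ∫ z, expNegGauge K z := (mass_expNegGauge_pos hc hk h0).le
  have h3 : 0 ≤ ∫ z, fderiv ℝ (gauge K) z x ^ 2 * expNegGauge K z :=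
    integral_nonneg fun z => mul_nonneg (sq_nonneg _) (Real.exp_pos _).le
  rw [ENNReal.toReal_mul, ENNReal.toReal_mul, ENNReal.toReal_ofReal hQ,
    ENNReal.toReal_ofReal hJ, ENNReal.toReal_ofReal h3] at h2
  have hV := volume_real_pos hk h0
  rw [div_mul_eq_mul_div, eq_div_iff hV.ne', mul_comm, mul_comm (mass _)]
  exact h2.symm

theorem integrable_funIntegrand_expNegGauge (hn : 1 ≤ n) (hc : Convex ℝ K) (hk : IsCompact K)
    (h0 : K ∈ 𝓝 0) (x : Space n) :
    Integrable (funIntegrand (expNegGauge K) x) (surfaceMeasure (expNegGauge K)) := by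
  have hfm : Measurable fun z => ENNReal.ofReal (expNegGauge K z) := by
    have := (isGauge_gauge hc hk h0).continuous.measurable
    unfold expNegGauge
    fun_prop
  rw [surfaceMeasure, integrable_map_measure
      (measurable_funIntegrand_expNegGauge hc hk h0 x).aestronglyMeasurable
      (measurable_gradient _).aemeasurable,
    integrable_withDensity_iff_integrable_smul' hfm (by simp)]
  refine ((integrable_fderiv_gauge_sq_mul hc hk h0 x).const_mul 2).congr ?_
  filter_upwards [ae_funIntegrand_gradient_eq hn hc hk h0 x] with z hz
  rw [Function.comp_apply, hz, ENNReal.toReal_ofReal (isLC_expNegGauge hc hk h0 |>.pos z).le, smul_eq_mul]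
  ring

theorem integral_funIntegrand_expNegGauge (hn : 1 ≤ n) (hc : Convex ℝ K) (hk : IsCompact K)
    (h0 : K ∈ 𝓝 0) (x : Space n) :
    ∫ y, funIntegrand (expNegGauge K) x y ∂surfaceMeasure (expNegGauge K) =
      2 * (mass (expNegGauge K) / volume.real K * gradientForm K x) := by
  have hfm : Measurable fun z => ENNReal.ofReal (expNegGauge K z) := by
    have := (isGauge_gauge hc hk h0).continuous.measurable
    unfold expNegGauge
    fun_prop
  rw [surfaceMeasure, integral_map (measurable_gradient _).aemeasurable
      (measurable_funIntegrand_expNegGauge hc hk h0 x).aestronglyMeasurable,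
    integral_withDensity_eq_integral_toReal_smul hfm (by simp),
    ← integral_fderiv_gauge_sq_mul hn hc hk h0 x, ← integral_const_mul]
  refine integral_congr_ae ?_
  filter_upwards [ae_funIntegrand_gradient_eq hn hc hk h0 x] with z hz
  rw [hz, ENNReal.toReal_ofReal (isLC_expNegGauge hc hk h0 |>.pos z).le, smul_eq_mul]
  ring

theorem funEllipsoid_expNegGauge (hn : 1 ≤ n) (hc : Convex ℝ K) (hk : IsCompact K)
    (h0 : K ∈ 𝓝 0) (x : Space n) :
    funEllipsoid (expNegGauge K) x = Real.exp (-(bodyForm K x / 2)) := by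
  have hJ := mass_expNegGauge_pos hc hk h0
  have hV := volume_real_pos hk h0
  have hn' : (0 : ℝ) < n := by exact_mod_cast hn
  rw [funEllipsoid, firstVariation_expNegGauge hc hk h0,
    integral_funIntegrand_expNegGauge hn hc hk h0, bodyForm_eq hn hc hk h0]
  congr 2
  field_simp
  norm_num

/-! ### The unit ball -/

theorem gauge_unitBall (x : Space n) : gauge (Metric.closedBall (0 : Space n) 1) x = ‖x‖ := by
  rw [gauge_closedBall zero_le_one, div_one]

theorem expNegGauge_unitBall : expNegGauge (Metric.closedBall (0 : Space n) 1) = gaussian n := by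
  ext x
  rw [expNegGauge, gauge_unitBall, gaussian]

theorem fderiv_norm_apply {z : Space n} (hz : z ≠ 0) (x : Space n) :
    fderiv ℝ (fun y : Space n => ‖y‖) z x = ‖z‖⁻¹ * ⟪z, x⟫_ℝ := by
  have h1 : DifferentiableAt ℝ (fun y : Space n => ‖y‖) z := (differentiableAt_id).norm ℝ hz
  have h2 := (h1.hasFDerivAt.pow 2).unique (hasStrictFDerivAt_norm_sq z).hasFDerivAt
  have h3 := congrArg (fun f => f x) h2
  have hz' : 0 < ‖z‖ := norm_pos_iff.2 hz
  simp only [smul_apply, innerSL_apply_apply, smul_eq_mul, nsmul_eq_mul, Nat.cast_ofNat,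
    Nat.add_one_sub_one, pow_one, mul_assoc] at h3
  rw [eq_inv_mul_iff_mul_eq₀ hz'.ne']
  linarith

theorem gradientForm_unitBall_eq (hn : 1 ≤ n) (x : Space n) :
    gradientForm (Metric.closedBall (0 : Space n) 1) x =
      ∫ z in Metric.closedBall (0 : Space n) 1, (‖z‖⁻¹ * ⟪z, x⟫_ℝ) ^ 2 := by
  have := nontrivial_space hn
  rw [gradientForm, show gauge (Metric.closedBall (0 : Space n) 1) = fun y => ‖y‖ from
    funext gauge_unitBall]
  refine integral_congr_ae (ae_restrict_of_ae ?_)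
  filter_upwards [compl_mem_ae_iff.2 (measure_singleton (0 : Space n))] with z hz
  rw [fderiv_norm_apply hz]

/-- By rotation invariance, `gradientForm` of the unit ball depends only on the norm. -/
theorem gradientForm_unitBall_congr (hn : 1 ≤ n) {x y : Space n} (h : ‖x‖ = ‖y‖) :
    gradientForm (Metric.closedBall (0 : Space n) 1) x =
      gradientForm (Metric.closedBall (0 : Space n) 1) y := by
  rw [gradientForm_unitBall_eq hn, gradientForm_unitBall_eq hn]
  set T := (ℝ ∙ (x - y))ᗮ.reflection with hT
  have hTx : T x = y := Submodule.reflection_sub h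
  have hpre : T ⁻¹' Metric.closedBall 0 1 = Metric.closedBall 0 1 := by
    ext z
    simp
  have h1 := T.measurePreserving.setIntegral_preimage_emb
    T.toHomeomorph.measurableEmbedding (fun z => (‖z‖⁻¹ * ⟪z, y⟫_ℝ) ^ 2) (Metric.closedBall 0 1)
  rw [hpre] at h1
  rw [← h1, ← hTx]
  simp only [LinearIsometryEquiv.norm_map, LinearIsometryEquiv.inner_map_map]

/-- The values of the form at the vectors of an orthonormal basis are equal and add up to the volume. -/
theorem mul_gradientForm_unitBall (hn : 1 ≤ n) {x : Space n} (hx : ‖x‖ = 1) :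
    n * gradientForm (Metric.closedBall (0 : Space n) 1) x =
      volume.real (Metric.closedBall (0 : Space n) 1) := by
  have := nontrivial_space hn
  set b := EuclideanSpace.basisFun (Fin n) ℝ with hb
  have hk : IsCompact (Metric.closedBall (0 : Space n) 1) := isCompact_closedBall _ _
  have h0 : Metric.closedBall (0 : Space n) 1 ∈ 𝓝 0 := Metric.closedBall_mem_nhds _ one_pos
  have h1 : ∑ i, gradientForm (Metric.closedBall (0 : Space n) 1) (b i) =
      n * gradientForm (Metric.closedBall (0 : Space n) 1) x := by
    rw [Finset.sum_congr rfl fun i _ => gradientForm_unitBall_congr hn (y := x)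
      (by rw [hx]; exact b.orthonormal.1 i)]
    simp
  rw [← h1]
  simp_rw [gradientForm]
  rw [← integral_finsetSum _ fun i _ =>
    integrableOn_fderiv_gauge_sq (convex_closedBall _ _) hk h0 (b i)]
  trans ∫ z in Metric.closedBall (0 : Space n) 1, (1 : ℝ)
  · refine integral_congr_ae (ae_restrict_of_ae ?_)
    filter_upwards [compl_mem_ae_iff.2 (measure_singleton (0 : Space n))] with z hz
    rw [show gauge (Metric.closedBall (0 : Space n) 1) = fun y => ‖y‖ from funext gauge_unitBall]
    simp_rw [fderiv_norm_apply hz, mul_pow]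
    rw [← Finset.mul_sum, b.sum_sq_inner_left, inv_pow, inv_mul_cancel₀]
    exact pow_ne_zero 2 (norm_ne_zero_iff.2 hz)
  · simp

theorem bodyForm_unitBall (hn : 1 ≤ n) (x : Space n) :
    bodyForm (Metric.closedBall (0 : Space n) 1) x = ‖x‖ ^ 2 := by
  have hc : Convex ℝ (Metric.closedBall (0 : Space n) 1) := convex_closedBall _ _
  have hk : IsCompact (Metric.closedBall (0 : Space n) 1) := isCompact_closedBall _ _
  have h0 : Metric.closedBall (0 : Space n) 1 ∈ 𝓝 0 := Metric.closedBall_mem_nhds _ one_pos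
  have := nontrivial_space hn
  obtain ⟨u, hu⟩ := exists_norm_eq (Space n) zero_le_one
  have h1 : ‖x‖ = ‖‖x‖ • u‖ := by rw [norm_smul, norm_norm, hu, mul_one]
  rw [bodyForm_eq hn hc hk h0, gradientForm_unitBall_congr hn h1, gradientForm_smul,
    ← mul_gradientForm_unitBall hn hu]
  have h2 := gradientForm_pos hc hk h0 (norm_ne_zero_iff.1 (by rw [hu]; exact one_ne_zero) : u ≠ 0)
  have h3 : (0 : ℝ) < n := by exact_mod_cast hn
  field_simp

theorem funEllipsoid_gaussian (hn : 1 ≤ n) : funEllipsoid (gaussian n) = gaussian n := by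
  ext x
  rw [← expNegGauge_unitBall, funEllipsoid_expNegGauge hn (convex_closedBall _ _)
    (isCompact_closedBall _ _) (Metric.closedBall_mem_nhds _ one_pos), bodyForm_unitBall hn,
    expNegGauge, gauge_unitBall]

end LYZ

theorem mainTheorem3 (n : ℕ) (hn : 1 ≤ n) :
    (∀ (K : ConvexBody (LYZ.Space n)) (f : LYZ.Space n → ℝ),
      (0 : LYZ.Space n) ∈ interior (K : Set (LYZ.Space n)) →
      f = LYZ.expNegGauge (K : Set (LYZ.Space n)) →
      -- the classical ellipsoid `Γ₋₂K` is well defined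
      (∀ u : LYZ.Space n, ‖u‖ = 1 →
        IntegrableOn (LYZ.bodyIntegrand (K : Set (LYZ.Space n)) u)
          (frontier (K : Set (LYZ.Space n))) (Measure.euclideanHausdorffMeasure (n - 1)) ∧
        0 < LYZ.bodyForm (K : Set (LYZ.Space n)) u) ∧
      -- the functional ellipsoid `Γ₋₂f` is well defined
      LYZ.IsLC f ∧
      (∀ y : LYZ.Space n, y ≠ 0 → 0 < LYZ.legendre (LYZ.potential f) y) ∧
      Tendsto (LYZ.massQuotient f f) (𝓝[>] (0 : ℝ)) (𝓝 (LYZ.firstVariation f f)) ∧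
      0 < LYZ.firstVariation f f ∧
      (∀ x : LYZ.Space n, Integrable (LYZ.funIntegrand f x) (LYZ.surfaceMeasure f)) ∧
      -- the two ellipsoids correspond to each other
      ∀ x : LYZ.Space n,
        LYZ.funEllipsoid f x =
          Real.exp (-(gauge (LYZ.bodyEllipsoid (K : Set (LYZ.Space n))) x ^ 2 / 2))) ∧
    LYZ.funEllipsoid (LYZ.gaussian n) = LYZ.gaussian n := by
  refine ⟨fun K f hK hf => ?_, LYZ.funEllipsoid_gaussian hn⟩
  subst hf
  have hc := K.convex
  have hk := K.isCompact
  have h0 := mem_interior_iff_mem_nhds.1 hK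
  have hn' : (0 : ℝ) < n := by exact_mod_cast hn
  have hJ := LYZ.mass_expNegGauge_pos hc hk h0
  refine ⟨fun u hu => ⟨LYZ.integrableOn_bodyIntegrand hn hc hk h0 u, LYZ.bodyForm_pos hn hc hk h0 ?_⟩,
    LYZ.isLC_expNegGauge hc hk h0, fun y hy => LYZ.legendre_potential_expNegGauge_pos hc hk h0 hy,
    ?_, ?_, fun x => LYZ.integrable_funIntegrand_expNegGauge hn hc hk h0 x, fun x => ?_⟩
  · exact norm_ne_zero_iff.1 (by rw [hu]; exact one_ne_zero)
  · rw [LYZ.firstVariation_expNegGauge hc hk h0]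
    exact LYZ.tendsto_massQuotient_expNegGauge hc hk h0
  · rw [LYZ.firstVariation_expNegGauge hc hk h0]
    positivity
  · rw [LYZ.funEllipsoid_expNegGauge hn hc hk h0, LYZ.gauge_bodyEllipsoid_sq hn hc hk h0]
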